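/- Let $\mathbb{T}^\infty$ be the infinite polytorus (a countably infinite product of circles) with its normalized Haar measure, and let $H^2(\mathbb{D}^\infty)\subset L^2(\mathbb{T}^\infty)$ be the closed linear span of the monomials $z^\kappa$, where $\kappa$ ranges over the finitely supported multi-indices of non-negative integers. For $\varphi\in L^2(\mathbb{T}^\infty)$, the multiplicative Hankel form with symbol $\varphi$ is $$H_\varphi(fg)=\langle fg,\varphi\rangle_{L^2(\mathbb{T}^\infty)}=\int_{\mathbb{T}^\infty} f\,g\,\overline{\varphi},$$ defined at least for analytic polynomials $f,g$ in finitely many of the variables $z_1,z_2,\dots$. We say that $H_\varphi$ has a bounded symbol if there is a $\psi\in L^\infty(\mathbb{T}^\infty)$ with $H_\varphi=H_\psi$ (as forms on analytic polynomials). The form $H_\varphi$ belongs to the Schatten class $\mathcal{S}_p$, $0<p<\infty$, if the operator $\mathbf{H}_\varphi f=\overline{P}(\overline{\varphi}f)$, initially defined for analytic polynomials $f$, where $\overline{P}$ is the orthogonal projection of $L^2(\mathbb{T}^\infty)$ onto the space $\overline{H^2}(\mathbb{D}^\infty)$ of complex conjugates of functions in $H^2(\mathbb{D}^\infty)$, extends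 to a compact operator from $H^2(\mathbb{D}^\infty)$ to $\overline{H^2}(\mathbb{D}^\infty)$ whose sequence of singular values (the square roots of the positive eigenvalues of $\mathbf{H}_\varphi^*\mathbf{H}_\varphi$, repeated according to multiplicity) is in $\ell^p$. **Theorem.** Let $p_0=\left(1-\frac{\log\pi}{\log 4}\right)^{-1}\approx 5.7388$. For every real $p>p_0$ there is a $\varphi\in L^2(\mathbb{T}^\infty)$ such that $H_\varphi\in\mathcal{S}_p$ and $H_\varphi$ does not have a bounded symbol. -/

import Mathlib

open MeasureTheory
open scoped ENNReal ComplexConjugate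

noncomputable section

namespace MultHankel

/-- The infinite polytorus `𝕋^∞`, a countable product of circles `ℝ/ℤ`.  The point with angles
`θ` has the complex coordinates `z_j = exp (2πi θ_j)`, see `coord`. -/
abbrev Polytorus : Type := ℕ → UnitAddCircle

/-- The Haar probability measure of `𝕋^∞`: the product of the normalized Lebesgue measures. -/
def haar : Measure Polytorus := Measure.infinitePi fun _ => AddCircle.haarAddCircle

instance : IsProbabilityMeasure haar := by unfold haar; infer_instance

/-- The complex coordinate `z_j` on the polytorus, a number of modulus one. -/
def coord (θ : Polytorus) (j : ℕ) : ℂ := (AddCircle.toCircle (θ j) : ℂ)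

/-- The function on the polytorus given by an analytic polynomial in `z_0, z_1, z_2, …`. -/
def polyFun (f : MvPolynomial ℕ ℂ) (θ : Polytorus) : ℂ := MvPolynomial.aeval (coord θ) f

theorem continuous_coord (j : ℕ) : Continuous fun θ : Polytorus => coord θ j :=
  continuous_subtype_val.comp (AddCircle.continuous_toCircle.comp (continuous_apply j))

theorem continuous_polyFun (f : MvPolynomial ℕ ℂ) : Continuous (polyFun f) := by
  induction f using MvPolynomial.induction_on with
  | C a =>
    have h : polyFun (MvPolynomial.C a) = fun _ => a := by funext θ; simp [polyFun]
    exact h ▸ continuous_const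
  | add p q hp hq =>
    have h : polyFun (p + q) = fun θ => polyFun p θ + polyFun q θ := by funext θ; simp [polyFun]
    exact h ▸ hp.add hq
  | mul_X p j hp =>
    have h : polyFun (p * MvPolynomial.X j) = fun θ => polyFun p θ * coord θ j := by
      funext θ; simp [polyFun]
    exact h ▸ hp.mul (continuous_coord j)

theorem exists_norm_polyFun_le (f : MvPolynomial ℕ ℂ) : ∃ C, ∀ θ, ‖polyFun f θ‖ ≤ C := by
  obtain ⟨C, hC⟩ := isCompact_univ.exists_bound_of_continuousOn (continuous_polyFun f).continuousOn
  exact ⟨C, fun θ => hC θ (Set.mem_univ θ)⟩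

theorem memLp_polyFun (f : MvPolynomial ℕ ℂ) : MemLp (polyFun f) 2 haar := by
  obtain ⟨C, hC⟩ := exists_norm_polyFun_le f
  exact MemLp.of_bound (continuous_polyFun f).aestronglyMeasurable C (Filter.Eventually.of_forall hC)

/-- The space `L²(𝕋^∞)`. -/
abbrev L2 : Type := Lp ℂ 2 haar

/-- The linear map sending an analytic polynomial to its class in `L²(𝕋^∞)`. -/
def polyL2 : MvPolynomial ℕ ℂ →ₗ[ℂ] L2 where
  toFun f := (memLp_polyFun f).toLp (polyFun f)
  map_add' f g := by
    rw [← MemLp.toLp_add]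
    congr 1
    funext θ
    simp [polyFun]
  map_smul' c f := by
    rw [RingHom.id_apply, ← MemLp.toLp_const_smul]
    congr 1
    funext θ
    simp [polyFun]

/-- The Hardy space `H²(𝔻^∞)`, as a subspace of `L²(𝕋^∞)`: the closed linear span of the monomials
`z^κ`, where `κ` runs through the finitely supported multi-indices of natural numbers. -/
def hardy : Submodule ℂ L2 := polyL2.range.topologicalClosure

theorem memLp_conj_polyFun (f : MvPolynomial ℕ ℂ) :
    MemLp (fun θ => conj (polyFun f θ)) 2 haar :=
  (memLp_polyFun f).star

/-- The anti-analytic space, which consists of the complex conjugates of the functions in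
`H²(𝔻^∞)`: the closed linear span of the conjugates of the analytic polynomials. -/
def antiHardy : Submodule ℂ L2 :=
  (Submodule.span ℂ (Set.range fun f : MvPolynomial ℕ ℂ =>
    (memLp_conj_polyFun f).toLp fun θ => conj (polyFun f θ))).topologicalClosure

instance : CompleteSpace hardy := by unfold hardy; infer_instance

instance : CompleteSpace antiHardy := by unfold antiHardy; infer_instance

/-- An analytic polynomial as an element of `H²(𝔻^∞)`. -/
def polyHardy (f : MvPolynomial ℕ ℂ) : hardy :=
  ⟨polyL2 f, Submodule.le_topologicalClosure _ (LinearMap.mem_range_self polyL2 f)⟩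

/-- The multiplicative Hankel form `H_φ(fg) = ⟨f g, φ⟩ = ∫ f g φ̄` with symbol `φ`, on pairs of
analytic polynomials (`φ` is a square integrable function wherever this is used). -/
def hankelForm (φ : Polytorus → ℂ) (f g : MvPolynomial ℕ ℂ) : ℂ :=
  ∫ θ, polyFun f θ * polyFun g θ * conj (φ θ) ∂haar

/-- `H_φ` has a bounded symbol: `H_φ = H_ψ` for some `ψ ∈ L^∞(𝕋^∞)`. -/
def HasBoundedSymbol (φ : L2) : Prop :=
  ∃ ψ : Lp ℂ ∞ haar, ∀ f g : MvPolynomial ℕ ℂ, hankelForm φ f g = hankelForm ψ f g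

theorem memLp_conj_mul_polyFun (φ : L2) (f : MvPolynomial ℕ ℂ) :
    MemLp (fun θ => conj (φ θ) * polyFun f θ) 2 haar := by
  obtain ⟨C, hC⟩ := exists_norm_polyFun_le f
  refine MemLp.of_le_mul (c := C) (Lp.memLp φ)
    ((Complex.continuous_conj.comp_aestronglyMeasurable (Lp.aestronglyMeasurable φ)).mul
      (continuous_polyFun f).aestronglyMeasurable) (Filter.Eventually.of_forall fun θ => ?_)
  rw [norm_mul, RCLike.norm_conj, mul_comm]
  exact mul_le_mul_of_nonneg_right (hC θ) (norm_nonneg _)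

/-- The small Hankel operator `f ↦ P̄(φ̄ f)` on analytic polynomials, where `P̄` is the orthogonal
projection of `L²(𝕋^∞)` onto the anti-analytic space. -/
def hankelOpPoly (φ : L2) (f : MvPolynomial ℕ ℂ) : antiHardy :=
  antiHardy.orthogonalProjectionOnto
    ((memLp_conj_mul_polyFun φ f).toLp fun θ => conj (φ θ) * polyFun f θ)

section Schatten

variable {E F : Type*} [NormedAddCommGroup E] [InnerProductSpace ℂ E] [CompleteSpace E]
  [NormedAddCommGroup F] [InnerProductSpace ℂ F] [CompleteSpace F]

/-- The multiplicity of `s > 0` as a singular value of `T`, that is, the dimension of the eigenspace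
of `T* T` with eigenvalue `s²`.  It is `0` if `s` is not a singular value, and for compact `T` the
eigenspace is finite dimensional. -/
def singularMultiplicity (T : E →L[ℂ] F) (s : ℝ) : ℕ :=
  Module.finrank ℂ (Module.End.eigenspace
    ((ContinuousLinearMap.adjoint T ∘L T : E →L[ℂ] E) : E →ₗ[ℂ] E) ((s : ℂ) ^ 2))

/-- The Schatten class `𝒮_p`, `0 < p < ∞`: the operator `T` is compact and the sum of `s ^ p` over
its singular values `s > 0`, counted with multiplicity, is finite. -/
def IsSchatten (p : ℝ) (T : E →L[ℂ] F) : Prop :=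
  IsCompactOperator T ∧
    Summable fun s : Set.Ioi (0 : ℝ) => (singularMultiplicity T s : ℝ) * (s : ℝ) ^ p

end Schatten

/-- `H_φ ∈ 𝒮_p`: the operator `f ↦ P̄(φ̄ f)`, initially defined on analytic polynomials, extends to a
bounded operator from `H²(𝔻^∞)` to the anti-analytic space that is of Schatten class `𝒮_p`. -/
def HankelInSchatten (p : ℝ) (φ : L2) : Prop :=
  ∃ T : hardy →L[ℂ] antiHardy,
    (∀ f : MvPolynomial ℕ ℂ, T (polyHardy f) = hankelOpPoly φ f) ∧ IsSchatten p T

end MultHankel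

end

/-!
For a block of `d` variables, let `ℓ = (z_1 + ⋯ + z_d) / √d`. Up to complex conjugation of the
values, the Hankel operator with symbol `ℓ` exchanges `1` and `ℓ`, and it vanishes on their
orthogonal complement, so it has two singular values, both equal to `1`. For a product of `n` such
forms in disjoint blocks of variables there are `2 ^ n` singular values equal to `1`: the product
over a subset of the blocks is sent to the conjugate of the product over the complement. The `𝒮_p`
norm is thus `2 ^ (n / p)`. A bounded symbol, on the other hand, has norm at least `⟨ℓ^{⊗ n}, ℓ^{⊗
n}⟩ / ‖ℓ^{⊗ n}‖₁ = ‖ℓ‖₁ ^ (-n)`, by independence of the blocks. By the central limit theorem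
`‖ℓ‖₁` comes arbitrarily close to `√π / 2` for large `d`, and `√π / 2 < 2 ^ (-1 / p)` is precisely
the condition on `p`.

The example is `φ = ∑ r ^ m Φ_m`, where `‖ℓ‖₁ < r < 2 ^ (-1 / p)` and the `Φ_m` are products of `m
+ 1` forms in disjoint blocks. Its Hankel operator can be diagonalized explicitly. The proper
nonempty subsets of the `m`-th group of blocks contribute fewer than `2 ^ (m + 1)` singular values
`r ^ m`, and the constants and `φ`, which are exchanged, contribute the singular value `‖φ‖`
twice. Since `2 * r ^ p < 1`, the operator is in `𝒮_p` (`hankelInSchatten_symbol`). Testing a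
bounded symbol `ψ` against `Φ_m` gives `r ^ m ≤ ‖ψ‖ * ‖ℓ‖₁ ^ (m + 1)` for all `m`, a contradiction
(`not_hasBoundedSymbol_symbol`).

The diagonalization rests on `inner_blockProd_mul`, which splits the pairing of a product of two
polynomials with a product of block forms over the subsets of the blocks, and on
`exists_isSchatten`, which bounds the multiplicities of the singular values of an operator on an
abstract Hilbert space that is given by a singular system. The norm `‖ℓ‖₁` is estimated in
`exists_blockMean_lt`: rotation invariance reduces it to the real part, to which the
one-dimensional central limit theorem applies.
-/

noncomputable section

namespace MultHankel

/-! ### Schatten operators from singular systems -/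

section SingularSystem

open Filter Topology InnerProductSpace

variable {ι E F : Type*} [NormedAddCommGroup E] [InnerProductSpace ℂ E]
  [NormedAddCommGroup F] [InnerProductSpace ℂ F]

/-- By Bessel's inequality, the norm of a finite sum of orthogonal rank one operators is at most its
largest weight. The tail of the singular value expansion is thus small in operator norm even if the
weights are not summable. -/
theorem norm_sum_smul_rankOne_le {e : ι → E} {f : ι → F} (he : Orthonormal ℂ e)
    (hf : Orthonormal ℂ f) (σ : ι → ℝ) (A : Finset ι) {C : ℝ} (hC : 0 ≤ C)
    (hσ : ∀ i ∈ A, |σ i| ≤ C) :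
    ‖∑ i ∈ A, (σ i : ℂ) • rankOne ℂ (f i) (e i)‖ ≤ C := by
  refine ContinuousLinearMap.opNorm_le_bound _ hC fun x => ?_
  have h1 : (∑ i ∈ A, (σ i : ℂ) • rankOne ℂ (f i) (e i)) x
      = ∑ i ∈ A, ((σ i : ℂ) * inner ℂ (e i) x) • f i := by
    simp [mul_smul]
  rw [h1]
  refine le_of_sq_le_sq ?_ (by positivity)
  have h2 : ‖∑ i ∈ A, ((σ i : ℂ) * inner ℂ (e i) x) • f i‖ ^ 2
      = ∑ i ∈ A, ‖(σ i : ℂ) * inner ℂ (e i) x‖ ^ 2 := by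
    have h := hf.inner_sum (fun i => (σ i : ℂ) * inner ℂ (e i) x)
      (fun i => (σ i : ℂ) * inner ℂ (e i) x) A
    rw [inner_self_eq_norm_sq_to_K] at h
    simp only [RCLike.conj_mul] at h
    exact_mod_cast h
  rw [h2]
  calc ∑ i ∈ A, ‖(σ i : ℂ) * inner ℂ (e i) x‖ ^ 2
      ≤ ∑ i ∈ A, C ^ 2 * ‖inner ℂ (e i) x‖ ^ 2 := by
        refine Finset.sum_le_sum fun i hi => ?_
        rw [norm_mul, mul_pow, Complex.norm_real, Real.norm_eq_abs]
        gcongr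
        exact hσ i hi
    _ ≤ C ^ 2 * ‖x‖ ^ 2 := by
        rw [← Finset.mul_sum]
        gcongr
        exact he.sum_inner_products_le x
    _ = (C * ‖x‖) ^ 2 := by ring

theorem isCompactOperator_smul_rankOne (c : ℂ) (x : F) (y : E) :
    IsCompactOperator (c • rankOne ℂ x y) := by
  have h : IsCompactOperator (rankOne ℂ x y) := by
    rw [rankOne_def']
    have hy : IsCompactOperator (innerSL ℂ y : E →L[ℂ] ℂ) :=
      isCompactOperator_of_locallyCompactSpace_dom _
    exact hy.clm_comp (ContinuousLinearMap.toSpanSingleton ℂ x)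
  exact h.smul c

variable [CompleteSpace F]

theorem summable_smul_rankOne {e : ι → E} {f : ι → F} (he : Orthonormal ℂ e)
    (hf : Orthonormal ℂ f) (σ : ι → ℝ) (hσ : Tendsto σ cofinite (𝓝 0)) :
    Summable fun i => (σ i : ℂ) • rankOne ℂ (f i) (e i) := by
  rw [summable_iff_vanishing_norm]
  intro ε hε
  have h1 : {i | ¬ |σ i| < ε / 2}.Finite := by
    have := (Metric.tendsto_nhds.1 hσ (ε / 2) (by positivity))
    simpa [Filter.eventually_cofinite] using this
  refine ⟨h1.toFinset, fun t ht => ?_⟩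
  refine (norm_sum_smul_rankOne_le he hf σ t (half_pos hε).le fun i hi => ?_).trans_lt
    (half_lt_self hε)
  by_contra hcon
  refine Finset.disjoint_left.1 ht hi ?_
  simp only [Set.Finite.mem_toFinset, Set.mem_ofPred_eq]
  exact fun h => hcon h.le

variable [CompleteSpace E]

/-- An eigenvector of `T* T` with eigenvalue `s²` has zero coefficients against every `e i` with
`σ i ≠ s`, and `T` vanishes on vectors orthogonal to all `e i`. So the eigenspace embeds into the
coefficients with `σ i = s`. -/
theorem singularMultiplicity_le_ncard {e : ι → E} {f : ι → F} (hf : Orthonormal ℂ f)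
    {σ : ι → ℝ} {T : E →L[ℂ] F}
    (hTe : ∀ i, T (e i) = (σ i : ℂ) • f i)
    (hT : ∀ x, HasSum (fun i => ((σ i : ℂ) * inner ℂ (e i) x) • f i) (T x))
    {s : ℝ} (hs : 0 < s) (hσ : ∀ i, 0 < σ i) (hfin : {i | σ i = s}.Finite) :
    singularMultiplicity T s ≤ {i | σ i = s}.ncard := by
  have hcoef : ∀ x i, inner ℂ (f i) (T x) = (σ i : ℂ) * inner ℂ (e i) x := by
    intro x i
    classical
    have h := (hT x).mapL (innerSL ℂ (f i))
    have h2 : HasSum (fun k => innerSL ℂ (f i) (((σ k : ℂ) * inner ℂ (e k) x) • f k))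
        ((σ i : ℂ) * inner ℂ (e i) x) := by
      have h3 := hasSum_single (f := fun k => innerSL ℂ (f i) (((σ k : ℂ) * inner ℂ (e k) x) • f k))
        i (by
          intro k hk
          simp [orthonormal_iff_ite.1 hf, hk.symm])
      simpa [inner_smul_right, orthonormal_iff_ite.1 hf, hf.1 i] using h3
    exact h.unique h2
  set V := Module.End.eigenspace
    ((ContinuousLinearMap.adjoint T ∘L T : E →L[ℂ] E) : E →ₗ[ℂ] E) ((s : ℂ) ^ 2) with hV
  have hmem : ∀ x ∈ V, ContinuousLinearMap.adjoint T (T x) = ((s : ℂ) ^ 2) • x := by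
    intro x hx
    have := Module.End.mem_eigenspace_iff.1 hx
    simpa using this
  have hvan : ∀ x ∈ V, ∀ i, σ i ≠ s → inner ℂ (e i) x = 0 := by
    intro x hx i hi
    have h1 : inner ℂ (e i) (ContinuousLinearMap.adjoint T (T x))
        = (σ i : ℂ) * ((σ i : ℂ) * inner ℂ (e i) x) := by
      rw [ContinuousLinearMap.adjoint_inner_right, hTe, inner_smul_left, hcoef, Complex.conj_ofReal]
    rw [hmem x hx, inner_smul_right] at h1
    have h2 : ((s : ℂ) ^ 2 - (σ i : ℂ) ^ 2) * inner ℂ (e i) x = 0 := by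
      linear_combination h1
    rcases mul_eq_zero.1 h2 with h | h
    · exfalso
      apply hi
      have h3 : (s : ℂ) ^ 2 = (σ i : ℂ) ^ 2 := sub_eq_zero.1 h
      have h4 : s ^ 2 = σ i ^ 2 := by exact_mod_cast h3
      exact ((sq_eq_sq₀ hs.le (hσ i).le).1 h4).symm
    · exact h
  have := hfin.fintype
  let L : V →ₗ[ℂ] ({i | σ i = s} → ℂ) :=
    LinearMap.pi fun i => (innerSL ℂ (e i)).toLinearMap ∘ₗ V.subtype
  have hL : Function.Injective L := by
    rw [← LinearMap.ker_eq_bot, LinearMap.ker_eq_bot']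
    rintro ⟨x, hx⟩ h
    have h0 : ∀ i, inner ℂ (e i) x = 0 := by
      intro i
      by_cases hi : σ i = s
      · exact congrFun h ⟨i, hi⟩
      · exact hvan x hx i hi
    have hTx : T x = 0 := by
      refine (hT x).unique ?_
      simp [h0]
    have h1 := hmem x hx
    rw [hTx, map_zero] at h1
    have h2 : x = 0 := by
      rcases smul_eq_zero.1 h1.symm with h | h
      · exfalso
        have : (s : ℂ) ≠ 0 := by exact_mod_cast hs.ne'
        exact this (pow_eq_zero_iff two_ne_zero |>.1 h)
      · exact h
    simpa using h2
  have h := LinearMap.finrank_le_finrank_of_injective hL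
  rw [Module.finrank_fintype_fun_eq_card] at h
  rw [Set.ncard_eq_toFinset_card', Set.toFinset_card]
  exact h

/-- Positive weights `σ` in `ℓ^p` and orthonormal families `e`, `f` define the operator
`∑ σ i ⟨e i, ·⟩ f i`, which belongs to the Schatten class `𝒮_p`. -/
theorem exists_isSchatten {e : ι → E} {f : ι → F} (he : Orthonormal ℂ e)
    (hf : Orthonormal ℂ f) {σ : ι → ℝ} (hσ : ∀ i, 0 < σ i) {p : ℝ} (hp : 0 < p)
    (hsum : Summable fun i => σ i ^ p) :
    ∃ T : E →L[ℂ] F, IsSchatten p T ∧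
      ∀ x, HasSum (fun i => ((σ i : ℂ) * inner ℂ (e i) x) • f i) (T x) := by
  classical
  have hlim : Tendsto σ cofinite (𝓝 0) := by
    have h := (hsum.tendsto_cofinite_zero).rpow_const (p := p⁻¹) (Or.inr (by positivity))
    rw [Real.zero_rpow (by positivity)] at h
    refine h.congr fun i => ?_
    rw [← Real.rpow_mul (hσ i).le, mul_inv_cancel₀ hp.ne', Real.rpow_one]
  have hS := summable_smul_rankOne he hf σ hlim
  set T := ∑' i, (σ i : ℂ) • rankOne ℂ (f i) (e i) with hTdef
  have hTx : ∀ x, HasSum (fun i => ((σ i : ℂ) * inner ℂ (e i) x) • f i) (T x) := by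
    intro x
    have h := hS.hasSum.mapL (ContinuousLinearMap.apply ℂ F x)
    rw [← hTdef] at h
    simpa [mul_smul] using h
  have hTe : ∀ i, T (e i) = (σ i : ℂ) • f i := by
    intro i
    refine (hTx (e i)).unique ?_
    have h3 := hasSum_single (f := fun k => ((σ k : ℂ) * inner ℂ (e k) (e i)) • f k)
        i (by
          intro k hk
          simp [orthonormal_iff_ite.1 he, hk])
    simpa [orthonormal_iff_ite.1 he, (he.1 i)] using h3
  refine ⟨T, ⟨?_, ?_⟩, hTx⟩
  · refine isCompactOperator_of_tendsto hS.hasSum (Eventually.of_forall fun A => ?_)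
    induction A using Finset.induction_on with
    | empty => simpa using isCompactOperator_zero
    | insert a A ha ih =>
      rw [Finset.sum_insert ha]
      exact (isCompactOperator_smul_rankOne _ _ _).add ih
  · have hfin : ∀ s : ℝ, 0 < s → {i | σ i = s}.Finite := by
      intro s hs
      have h1 := Metric.tendsto_nhds.1 hlim s hs
      rw [Filter.eventually_cofinite] at h1
      refine h1.subset fun i hi => ?_
      simp only [Set.mem_ofPred_eq] at hi
      simp [hi, abs_of_pos hs]
    -- Grouping the indices by the value of `σ` turns `∑ σ i ^ p` into the sum over singular values.
    let τ : ι → Set.Ioi (0 : ℝ) := fun i => ⟨σ i, hσ i⟩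
    have h2 : Summable fun q : Σ s : Set.Ioi (0 : ℝ), {i // τ i = s} => σ q.2 ^ p :=
      (Equiv.sigmaFiberEquiv τ).summable_iff.2 hsum
    have h3 := h2.sigma
    refine Summable.of_nonneg_of_le (fun s => ?_) (fun s => ?_) h3
    · have := s.2
      simp only [Set.mem_Ioi] at this
      positivity
    · have hs : (0 : ℝ) < s := s.2
      have h4 : ∀ c : {i // τ i = s}, σ c ^ p = (s : ℝ) ^ p := by
        rintro ⟨i, hi⟩
        exact congrArg (fun t : Set.Ioi (0 : ℝ) => (t : ℝ) ^ p) hi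
      simp_rw [h4]
      rw [tsum_const, nsmul_eq_mul]
      gcongr
      have h5 := singularMultiplicity_le_ncard hf hTe hTx hs hσ (hfin s hs)
      refine h5.trans_eq ?_
      rw [← Nat.card_coe_set_eq]
      refine Nat.card_congr (Equiv.subtypeEquivRight fun i => ?_)
      simp [τ, Subtype.ext_iff]

end SingularSystem

/-! ### Orthonormality of the monomials -/

section Monomials

open MvPolynomial

theorem haar_map_add (c : Polytorus) : haar.map (fun θ i => θ i + c i) = haar := by
  unfold haar
  rw [Measure.infinitePi_map_pi _ (f := fun i x => x + c i) (fun i => by fun_prop)]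
  congr 1
  funext i
  exact map_add_right_eq_self _ _

/-- Translation invariance of the Haar measure. -/
theorem integral_haar_add {E : Type*} [NormedAddCommGroup E] [NormedSpace ℝ E]
    {f : Polytorus → E} (hf : Continuous f) (c : Polytorus) :
    ∫ θ, f (fun i => θ i + c i) ∂haar = ∫ θ, f θ ∂haar := by
  conv_rhs => rw [← haar_map_add c]
  have hm : Measurable fun (θ : Polytorus) i => θ i + c i := by fun_prop
  rw [integral_map hm.aemeasurable hf.aestronglyMeasurable]

theorem inner_toLp {f g : Polytorus → ℂ} (hf : MemLp f 2 haar) (hg : MemLp g 2 haar) :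
    inner ℂ (hf.toLp f) (hg.toLp g) = ∫ θ, g θ * conj (f θ) ∂haar := by
  rw [L2.inner_def]
  refine integral_congr_ae ?_
  filter_upwards [hf.coeFn_toLp, hg.coeFn_toLp] with θ h1 h2
  rw [h1, h2]
  rfl

theorem inner_polyL2 (f g : MvPolynomial ℕ ℂ) :
    inner ℂ (polyL2 f) (polyL2 g) = ∫ θ, polyFun g θ * conj (polyFun f θ) ∂haar :=
  inner_toLp (memLp_polyFun f) (memLp_polyFun g)

theorem norm_toCircle (t : UnitAddCircle) : ‖(AddCircle.toCircle t : ℂ)‖ = 1 :=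
  Circle.norm_coe _

theorem polyFun_monomial_add_single (κ : ℕ →₀ ℕ) (j : ℕ) (t : UnitAddCircle) (θ : Polytorus) :
    polyFun (monomial κ 1) (fun i => θ i + (Pi.single j t : Polytorus) i)
      = (AddCircle.toCircle t : ℂ) ^ κ j * polyFun (monomial κ 1) θ := by
  have h : ∀ i, coord (fun i => θ i + (Pi.single j t : Polytorus) i) i
      = coord θ i * (if i = j then (AddCircle.toCircle t : ℂ) else 1) := by
    intro i
    by_cases hi : i = j
    · subst hi
      simp [coord, AddCircle.toCircle_add]
    · simp [coord, hi]
  simp only [polyFun, aeval_monomial, map_one, one_mul, h, mul_pow, Finsupp.prod]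
  rw [Finset.prod_mul_distrib, mul_comm]
  congr 1
  simp only [ite_pow, one_pow]
  rw [Finset.prod_ite_eq']
  split_ifs with hj
  · rfl
  · rw [Finsupp.notMem_support_iff.1 hj, pow_zero]

theorem exists_toCircle_pow_ne {k l : ℕ} (h : k ≠ l) :
    ∃ t : UnitAddCircle, (AddCircle.toCircle t : ℂ) ^ k ≠ (AddCircle.toCircle t : ℂ) ^ l := by
  wlog hkl : k < l generalizing k l
  · obtain ⟨t, ht⟩ := this h.symm (by omega)
    exact ⟨t, ht.symm⟩
  obtain ⟨n, rfl⟩ := Nat.exists_eq_add_of_lt hkl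
  refine ⟨((1 / (2 * ((n : ℝ) + 1)) : ℝ) : UnitAddCircle), fun hcon => ?_⟩
  set u := AddCircle.toCircle ((1 / (2 * ((n : ℝ) + 1)) : ℝ) : UnitAddCircle) with hu
  have h1 : u ^ (n + 1) = 1 := by
    have h2 : u ^ k = u ^ (k + n + 1) := by
      apply Subtype.ext
      simpa using hcon
    rw [add_assoc, pow_add] at h2
    exact (left_eq_mul.1 h2)
  rw [hu, ← AddCircle.toCircle_nsmul, ← AddCircle.toCircle_zero] at h1
  have h3 := AddCircle.injective_toCircle one_ne_zero h1
  rw [← AddCircle.coe_nsmul, AddCircle.coe_eq_zero_iff] at h3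
  obtain ⟨m, hm⟩ := h3
  have h4 : (m : ℝ) * 2 = 1 := by
    simp only [zsmul_eq_mul, mul_one, nsmul_eq_mul] at hm
    rw [hm]
    push_cast
    field_simp
  have h5 : m * 2 = 1 := by exact_mod_cast h4
  omega

/-- If `κ j ≠ μ j`, a translation in the coordinate `j` multiplies the inner product by a number
other than `1`, so the inner product vanishes. -/
theorem inner_polyL2_monomial (κ μ : ℕ →₀ ℕ) :
    inner ℂ (polyL2 (monomial κ 1)) (polyL2 (monomial μ 1)) = if κ = μ then (1 : ℂ) else 0 := by
  rw [inner_polyL2]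
  split_ifs with h
  · subst h
    have h1 : ∀ θ, polyFun (monomial κ 1) θ * conj (polyFun (monomial κ 1) θ) = 1 := by
      intro θ
      rw [Complex.mul_conj, Complex.normSq_eq_norm_sq]
      have : ‖polyFun (monomial κ 1) θ‖ = 1 := by
        simp [polyFun, aeval_monomial, Finsupp.prod, coord, norm_toCircle]
      simp [this]
    simp [h1]
  · obtain ⟨j, hj⟩ : ∃ j, κ j ≠ μ j := by
      by_contra hcon
      push Not at hcon
      exact h (Finsupp.ext hcon)
    obtain ⟨t, ht⟩ := exists_toCircle_pow_ne hj
    have hc : Continuous fun θ => polyFun (monomial μ 1) θ * conj (polyFun (monomial κ 1) θ) :=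
      (continuous_polyFun _).mul (Complex.continuous_conj.comp (continuous_polyFun _))
    have h1 := integral_haar_add hc (Pi.single j t)
    simp only [polyFun_monomial_add_single] at h1
    set u : ℂ := (AddCircle.toCircle t : ℂ) with hu
    have hun : u * conj u = 1 := by
      rw [Complex.mul_conj, Complex.normSq_eq_norm_sq]
      simp [hu, norm_toCircle]
    set J := ∫ θ, polyFun (monomial μ 1) θ * conj (polyFun (monomial κ 1) θ) ∂haar
    have h2 : u ^ μ j * conj (u ^ κ j) * J = J := by
      refine Eq.trans ?_ h1
      rw [← integral_const_mul]
      congr 1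
      funext θ
      rw [map_mul]
      ring
    have h3 : (u ^ μ j - u ^ κ j) * J = 0 := by
      have h4 : u ^ κ j * conj (u ^ κ j) = 1 := by
        rw [map_pow, ← mul_pow, hun, one_pow]
      linear_combination u ^ κ j * h2 - u ^ μ j * J * h4
    rcases mul_eq_zero.1 h3 with h5 | h5
    · exact absurd (sub_eq_zero.1 h5).symm ht
    · exact h5

theorem inner_monomial_polyL2 (κ : ℕ →₀ ℕ) (f : MvPolynomial ℕ ℂ) :
    inner ℂ (polyL2 (monomial κ 1)) (polyL2 f) = coeff κ f := by
  induction f using MvPolynomial.induction_on' with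
  | monomial μ c =>
    rw [← mul_one c, ← smul_eq_mul, ← smul_monomial, map_smul, inner_smul_right,
      inner_polyL2_monomial, coeff_smul, coeff_monomial]
    simp [eq_comm]
  | add p q hp hq => rw [map_add, inner_add_right, hp, hq, coeff_add]

end Monomials

/-! ### Products of block forms and the collapse homomorphism -/

section Blocks

open MvPolynomial

/-- The normalized linear form `(z_{dj} + ⋯ + z_{dj+d-1}) / √d` in the `j`-th block of `d`
variables. Distinct blocks use disjoint sets of variables. -/
def blockForm (d j : ℕ) : MvPolynomial ℕ ℂ :=
  C (((√d)⁻¹ : ℝ) : ℂ) * ∑ i ∈ Finset.range d, X (d * j + i)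

/-- The product of the block forms with indices in `S`. -/
def blockProd (d : ℕ) (S : Finset ℕ) : MvPolynomial ℕ ℂ := ∏ j ∈ S, blockForm d j

/-- The algebra homomorphism that sends every variable of the `j`-th block to `z_j / √d`. Up to
the identification of `∏_{j ∈ S} z_j` with `blockProd d S`, it computes inner products against
products of block forms, see `inner_blockProd`. -/
def collapse (d : ℕ) : MvPolynomial ℕ ℂ →ₐ[ℂ] MvPolynomial ℕ ℂ :=
  aeval fun n => C (((√d)⁻¹ : ℝ) : ℂ) * X (n / d)

/-- The exponent of the squarefree monomial `∏_{j ∈ S} z_j`. -/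
def indicatorExp (S : Finset ℕ) : ℕ →₀ ℕ := ∑ j ∈ S, Finsupp.single j 1

theorem indicatorExp_apply (S : Finset ℕ) (n : ℕ) :
    indicatorExp S n = if n ∈ S then 1 else 0 := by
  simp [indicatorExp, Finsupp.finsetSum_apply, Finsupp.single_apply]

theorem indicatorExp_injective : Function.Injective indicatorExp := by
  intro S T h
  ext n
  have := DFunLike.congr_fun h n
  rw [indicatorExp_apply, indicatorExp_apply] at this
  by_cases h1 : n ∈ S <;> by_cases h2 : n ∈ T <;> simp_all

theorem collapse_monomial (d : ℕ) (κ : ℕ →₀ ℕ) :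
    collapse d (monomial κ 1)
      = monomial (κ.mapDomain (· / d)) ((((√d)⁻¹ : ℝ) : ℂ) ^ κ.degree) := by
  induction κ using Finsupp.induction_linear with
  | zero => simp [collapse]
  | add κ μ h1 h2 =>
    rw [← one_mul (1 : ℂ), ← monomial_mul, map_mul, h1, h2, monomial_mul, Finsupp.mapDomain_add,
      map_add, pow_add]
  | single n k =>
    rw [Finsupp.mapDomain_single, Finsupp.degree_single, collapse, aeval_monomial, map_one, one_mul,
      Finsupp.prod_single_index (by simp), mul_pow, ← C_pow, X_pow_eq_monomial, C_mul_monomial,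
      mul_one]

theorem collapse_blockForm {d : ℕ} (hd : 0 < d) (j : ℕ) : collapse d (blockForm d j) = X j := by
  have h1 : ∀ i ∈ Finset.range d, collapse d (X (d * j + i))
      = C (((√d)⁻¹ : ℝ) : ℂ) * X j := by
    intro i hi
    rw [collapse, aeval_X]
    congr 2
    rw [Nat.mul_add_div hd, Nat.div_eq_of_lt (Finset.mem_range.1 hi), add_zero]
  have hs : (√d : ℝ) ≠ 0 := by positivity
  have h2 : (((√d)⁻¹ : ℝ) : ℂ) * ((d : ℂ) * (((√d)⁻¹ : ℝ) : ℂ)) = 1 := by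
    have h3 : (√d)⁻¹ * ((d : ℝ) * (√d)⁻¹) = 1 := by
      nth_rw 2 [← Real.mul_self_sqrt (Nat.cast_nonneg d)]
      field_simp
    exact_mod_cast h3
  rw [blockForm, map_mul, map_sum, Finset.sum_congr rfl h1, Finset.sum_const, Finset.card_range,
    nsmul_eq_mul, ← map_natCast (C (σ := ℕ) (R := ℂ)), ← mul_assoc, ← mul_assoc]
  have h4 : collapse d (C (((√d)⁻¹ : ℝ) : ℂ)) = C (((√d)⁻¹ : ℝ) : ℂ) := by
    simp [collapse]
  rw [h4, ← C_mul, ← C_mul, mul_assoc, h2, C_1, one_mul]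

theorem monomial_indicatorExp (S : Finset ℕ) :
    (monomial (indicatorExp S) (1 : ℂ)) = ∏ j ∈ S, X j := by
  rw [indicatorExp, monomial_sum_one]
  rfl

theorem collapse_blockProd {d : ℕ} (hd : 0 < d) (S : Finset ℕ) :
    collapse d (blockProd d S) = monomial (indicatorExp S) 1 := by
  rw [blockProd, map_prod, monomial_indicatorExp]
  exact Finset.prod_congr rfl fun j _ => collapse_blockForm hd j

/-- The total degree of `z^μ` in the `j`-th block is the exponent of `z_j` after collapsing. -/
theorem sum_range_block_eq_mapDomain {d : ℕ} (hd : 0 < d) (μ : ℕ →₀ ℕ) (j : ℕ) :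
    ∑ i ∈ Finset.range d, μ (d * j + i) = μ.mapDomain (· / d) j := by
  induction μ using Finsupp.induction_linear with
  | zero => simp
  | add κ μ h1 h2 =>
    simp [Finset.sum_add_distrib, Finsupp.mapDomain_add, h1, h2]
  | single n k =>
    rw [Finsupp.mapDomain_single]
    simp only [Finsupp.single_apply]
    by_cases hn : n / d = j
    · rw [if_pos hn, Finset.sum_eq_single (n % d)]
      · rw [if_pos]
        rw [← hn, Nat.div_add_mod]
      · intro i hi hne
        rw [if_neg]
        intro h
        apply hne
        rw [h, Nat.mul_add_mod, Nat.mod_eq_of_lt (Finset.mem_range.1 hi)]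
      · intro h
        exact absurd (Finset.mem_range.2 (Nat.mod_lt _ hd)) h
    · rw [if_neg hn]
      refine Finset.sum_eq_zero fun i hi => if_neg ?_
      intro h
      apply hn
      rw [h, Nat.mul_add_div hd, Nat.div_eq_of_lt (Finset.mem_range.1 hi), add_zero]

/-- The monomials of `blockProd d S` are those with exactly one variable from each block in `S`. -/
theorem coeff_blockProd {d : ℕ} (hd : 0 < d) (S : Finset ℕ) (μ : ℕ →₀ ℕ) :
    coeff μ (blockProd d S)
      = if μ.mapDomain (· / d) = indicatorExp S then (((√d)⁻¹ : ℝ) : ℂ) ^ μ.degree else 0 := by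
  classical
  induction S using Finset.induction_on generalizing μ with
  | empty =>
    have h : μ.mapDomain (· / d) = 0 ↔ μ = 0 := by
      refine ⟨fun h => ?_, fun h => by simp [h]⟩
      ext n
      have h1 := sum_range_block_eq_mapDomain hd μ (n / d)
      rw [h, Finsupp.coe_zero, Pi.zero_apply, Finset.sum_eq_zero_iff] at h1
      have h2 := h1 (n % d) (Finset.mem_range.2 (Nat.mod_lt _ hd))
      rwa [Nat.div_add_mod] at h2
    rw [blockProd, Finset.prod_empty, coeff_one, indicatorExp, Finset.sum_empty]
    by_cases hμ : μ = 0
    · simp [hμ]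
    · rw [if_neg (Ne.symm hμ), if_neg (fun h1 => hμ (h.1 h1))]
  | insert j S hj ih =>
    set a : ℂ := (((√d)⁻¹ : ℝ) : ℂ) with ha
    have hind : indicatorExp (insert j S) = indicatorExp S + Finsupp.single j 1 := by
      rw [indicatorExp, Finset.sum_insert hj, add_comm]
      rfl
    -- Dividing out one variable of the block `j` lowers the collapsed exponent by `single j 1`.
    have hterm : ∀ i ∈ Finset.range d, coeff μ (X (d * j + i) * blockProd d S)
        = if d * j + i ∈ μ.support ∧ μ.mapDomain (· / d) = indicatorExp (insert j S) then
            a ^ (μ.degree - 1) else 0 := by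
      intro i hi
      rw [coeff_X_mul']
      by_cases hmem : d * j + i ∈ μ.support
      · rw [if_pos hmem, ih]
        have hle : Finsupp.single (d * j + i) 1 ≤ μ := by
          rw [Finsupp.single_le_iff]
          exact Nat.one_le_iff_ne_zero.2 (Finsupp.mem_support_iff.1 hmem)
        obtain ⟨ν, rfl⟩ := exists_add_of_le hle
        have hdiv : (d * j + i) / d = j := by
          rw [Nat.mul_add_div hd, Nat.div_eq_of_lt (Finset.mem_range.1 hi), add_zero]
        rw [add_tsub_cancel_left, Finsupp.mapDomain_add, Finsupp.mapDomain_single, hdiv, hind,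
          map_add, Finsupp.degree_single, add_tsub_cancel_left, add_comm (Finsupp.single j 1)]
        simp only [add_left_inj, hmem, true_and]
      · rw [if_neg hmem, if_neg (fun h => hmem h.1)]
    rw [blockProd, Finset.prod_insert hj, blockForm, mul_assoc, coeff_C_mul, Finset.sum_mul,
      coeff_sum]
    change a * ∑ i ∈ Finset.range d, coeff μ (X (d * j + i) * blockProd d S) = _
    rw [Finset.sum_congr rfl hterm]
    by_cases hμ : μ.mapDomain (· / d) = indicatorExp (insert j S)
    · have hsum := sum_range_block_eq_mapDomain hd μ j
      rw [hμ, indicatorExp_apply, if_pos (Finset.mem_insert_self j S)] at hsum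
      -- The block `j` has total degree one in `μ`, so exactly one variable contributes.
      have hone : ∑ i ∈ Finset.range d, (if d * j + i ∈ μ.support then a ^ (μ.degree - 1) else 0)
          = a ^ (μ.degree - 1) := by
        have h1 : ∀ i ∈ Finset.range d, (if d * j + i ∈ μ.support then a ^ (μ.degree - 1) else 0)
            = (μ (d * j + i) : ℂ) * a ^ (μ.degree - 1) := by
          intro i hi
          have hle : μ (d * j + i) ≤ 1 := by
            rw [← hsum]
            exact Finset.single_le_sum (f := fun i => μ (d * j + i)) (fun _ _ => Nat.zero_le _) hi
          by_cases h0 : μ (d * j + i) = 0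
          · simp [h0]
          · have : μ (d * j + i) = 1 := by omega
            simp [this]
        rw [Finset.sum_congr rfl h1, ← Finset.sum_mul, ← Nat.cast_sum, hsum, Nat.cast_one, one_mul]
      have hdeg : μ.degree ≠ 0 := by
        intro h0
        rw [Finsupp.degree_eq_zero_iff] at h0
        simp [h0] at hsum
      simp only [hμ, and_true, if_true]
      rw [hone, ← pow_succ', Nat.sub_add_cancel (Nat.one_le_iff_ne_zero.2 hdeg)]
    · simp [hμ]

theorem inner_blockProd {d : ℕ} (hd : 0 < d) (S : Finset ℕ) (f : MvPolynomial ℕ ℂ) :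
    inner ℂ (polyL2 (blockProd d S)) (polyL2 f) = coeff (indicatorExp S) (collapse d f) := by
  classical
  induction f using MvPolynomial.induction_on' with
  | monomial μ c =>
    rw [← mul_one c, ← smul_eq_mul, ← smul_monomial, map_smul, inner_smul_right,
      map_smul, coeff_smul, collapse_monomial, coeff_monomial, ← inner_conj_symm,
      inner_monomial_polyL2, coeff_blockProd hd]
    split_ifs <;> simp
  | add p q hp hq => rw [map_add, inner_add_right, hp, hq, map_add, coeff_add]

theorem inner_blockProd_blockProd {d : ℕ} (hd : 0 < d) (S T : Finset ℕ) :
    inner ℂ (polyL2 (blockProd d S)) (polyL2 (blockProd d T)) = if S = T then (1 : ℂ) else 0 := by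
  classical
  rw [inner_blockProd hd, collapse_blockProd hd, coeff_monomial]
  simp only [indicatorExp_injective.eq_iff, eq_comm]

/-- A coproduct formula: as `collapse d` is multiplicative, pairing a product `f * g` with
`blockProd d U` splits into a sum over the decompositions of `U` into two disjoint subsets. -/
theorem inner_blockProd_mul {d : ℕ} (hd : 0 < d) (U : Finset ℕ) (f g : MvPolynomial ℕ ℂ) :
    inner ℂ (polyL2 (blockProd d U)) (polyL2 (f * g))
      = ∑ S ∈ U.powerset, inner ℂ (polyL2 (blockProd d S)) (polyL2 f) *
          inner ℂ (polyL2 (blockProd d (U \ S))) (polyL2 g) := by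
  classical
  simp only [inner_blockProd hd]
  rw [map_mul, coeff_mul]
  symm
  refine Finset.sum_bij (fun S _ => (indicatorExp S, indicatorExp (U \ S))) ?_ ?_ ?_ ?_
  · intro S hS
    rw [Finset.mem_powerset] at hS
    rw [Finset.HasAntidiagonal.mem_antidiagonal]
    ext n
    simp only [Finsupp.add_apply, indicatorExp_apply, Finset.mem_sdiff]
    have := @hS n
    by_cases h1 : n ∈ S <;> by_cases h2 : n ∈ U <;> simp_all
  · intro S _ T _ h
    exact indicatorExp_injective (Prod.ext_iff.1 h).1
  · rintro ⟨κ, μ⟩ h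
    rw [Finset.HasAntidiagonal.mem_antidiagonal] at h
    have hn : ∀ n, κ n + μ n = if n ∈ U then 1 else 0 := by
      intro n
      rw [← indicatorExp_apply, ← h, Finsupp.add_apply]
    refine ⟨κ.support, ?_, ?_⟩
    · rw [Finset.mem_powerset]
      intro n hκ
      have h1 := hn n
      by_contra h2
      rw [if_neg h2] at h1
      rw [Finsupp.mem_support_iff] at hκ
      omega
    · rw [Prod.mk.injEq]
      constructor
      · ext n
        have h1 := hn n
        rw [indicatorExp_apply]
        simp only [Finsupp.mem_support_iff]
        split_ifs at h1 ⊢ <;> omega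
      · ext n
        have h1 := hn n
        rw [indicatorExp_apply]
        simp only [Finset.mem_sdiff, Finsupp.mem_support_iff]
        split_ifs at h1 ⊢ <;> grind
  · intro S _
    rfl

end Blocks

/-! ### Complex conjugation and inner products of Hankel operators -/

section Conjugation

theorem inner_star_star (a b : L2) : inner ℂ (star a) (star b) = inner ℂ b a := by
  rw [L2.inner_def, L2.inner_def]
  refine integral_congr_ae ?_
  filter_upwards [Lp.coeFn_star a, Lp.coeFn_star b] with θ h1 h2
  rw [h1, h2]
  simp [mul_comm]

/-- Complex conjugation reverses inner products, hence preserves distances. -/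
theorem isometry_star_L2 : Isometry (star : L2 → L2) := by
  refine Isometry.of_dist_eq fun a b => ?_
  rw [dist_eq_norm, dist_eq_norm, ← sq_eq_sq₀ (norm_nonneg _) (norm_nonneg _),
    @norm_sub_sq ℂ, @norm_sub_sq ℂ, inner_star_star, ← inner_conj_symm, RCLike.conj_re,
    @norm_sq_eq_re_inner ℂ, @norm_sq_eq_re_inner ℂ _ _ _ _ (star b), inner_star_star,
    inner_star_star, ← @norm_sq_eq_re_inner ℂ, ← @norm_sq_eq_re_inner ℂ]

theorem star_polyL2 (f : MvPolynomial ℕ ℂ) :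
    star (polyL2 f) = (memLp_conj_polyFun f).toLp fun θ => conj (polyFun f θ) := by
  refine Lp.ext ?_
  filter_upwards [Lp.coeFn_star (polyL2 f), (memLp_polyFun f).coeFn_toLp,
    (memLp_conj_polyFun f).coeFn_toLp] with θ h1 h2 h3
  rw [h1, h3, Pi.star_apply]
  exact congrArg star h2

theorem star_polyL2_mem (f : MvPolynomial ℕ ℂ) : star (polyL2 f) ∈ antiHardy := by
  rw [star_polyL2]
  exact Submodule.le_topologicalClosure _ (Submodule.subset_span ⟨f, rfl⟩)

theorem star_mem_antiHardy {a : L2} (ha : a ∈ hardy) : star a ∈ antiHardy := by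
  have h1 : a ∈ closure (Set.range polyL2) := ha
  have h2 := map_mem_closure isometry_star_L2.continuous h1
    (t := (antiHardy : Set L2)) (by rintro _ ⟨f, rfl⟩; exact star_polyL2_mem f)
  have hcl : IsClosed (antiHardy : Set L2) := Submodule.isClosed_topologicalClosure _
  rwa [hcl.closure_eq] at h2

/-- Complex conjugation as a map from the Hardy space to the anti-analytic space. -/
def conjHardy (a : hardy) : antiHardy := ⟨star (a : L2), star_mem_antiHardy a.2⟩

theorem inner_conjHardy (a b : hardy) :
    inner ℂ (conjHardy a) (conjHardy b) = inner ℂ b a :=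
  inner_star_star _ _

/-- The conjugates of polynomials span a dense subspace of the anti-analytic space, so they separate
its points. -/
theorem antiHardy_ext {u v : antiHardy}
    (h : ∀ g, inner ℂ (conjHardy (polyHardy g)) u = inner ℂ (conjHardy (polyHardy g)) v) :
    u = v := by
  have h1 : ∀ w ∈ antiHardy, inner ℂ w ((u - v : antiHardy) : L2) = 0 := by
    intro w hw
    have hcl : IsClosed {w : L2 | inner ℂ w ((u - v : antiHardy) : L2) = 0} :=
      isClosed_eq (by fun_prop) continuous_const
    refine closure_minimal ?_ hcl hw
    intro w hw
    refine Submodule.span_induction ?_ ?_ ?_ ?_ hw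
    · rintro _ ⟨g, rfl⟩
      have h2 : inner ℂ (star (polyL2 g)) (u : L2) = inner ℂ (star (polyL2 g)) (v : L2) := h g
      have h3 : inner ℂ (star (polyL2 g)) ((u - v : antiHardy) : L2) = 0 := by
        rw [Submodule.coe_sub, inner_sub_right, h2, sub_self]
      rwa [star_polyL2] at h3
    · simp
    · intro x y _ _ hx hy
      change inner ℂ (x + y) ((u - v : antiHardy) : L2) = 0
      rw [inner_add_left]
      have hx' : inner ℂ x ((u - v : antiHardy) : L2) = 0 := hx
      have hy' : inner ℂ y ((u - v : antiHardy) : L2) = 0 := hy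
      rw [hx', hy', add_zero]
    · intro c x _ hx
      change inner ℂ (c • x) ((u - v : antiHardy) : L2) = 0
      have hx' : inner ℂ x ((u - v : antiHardy) : L2) = 0 := hx
      rw [inner_smul_left, hx', mul_zero]
  have h4 := h1 _ (u - v).2
  rw [inner_self_eq_zero] at h4
  exact sub_eq_zero.1 (Subtype.ext h4)

theorem hankelForm_eq_inner (φ : L2) (f g : MvPolynomial ℕ ℂ) :
    hankelForm φ f g = inner ℂ φ (polyL2 (f * g)) := by
  rw [L2.inner_def, hankelForm]
  refine integral_congr_ae ?_
  filter_upwards [(memLp_polyFun (f * g)).coeFn_toLp] with θ h1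
  have h2 : (polyL2 (f * g) : Polytorus → ℂ) θ = polyFun f θ * polyFun g θ := by
    refine Eq.trans h1 ?_
    simp [polyFun]
  rw [h2]
  rfl

theorem inner_conjHardy_hankelOpPoly (φ : L2) (f g : MvPolynomial ℕ ℂ) :
    inner ℂ (conjHardy (polyHardy g)) (hankelOpPoly φ f) = inner ℂ φ (polyL2 (f * g)) := by
  rw [hankelOpPoly, Submodule.inner_orthogonalProjectionOnto_eq_of_mem_left]
  change inner ℂ (star (polyL2 g)) _ = _
  rw [star_polyL2, inner_toLp, ← hankelForm_eq_inner, hankelForm]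
  congr 1
  funext θ
  rw [Complex.conj_conj]
  ring

end Conjugation

/-! ### The symbol -/

section Symbol

open MvPolynomial

/-- Pairwise disjoint finite sets of block indices, the `m`-th one with `m + 1` elements. The
shift by one keeps every group nonempty. -/
def blockGroup (m : ℕ) : Finset ℕ := (Finset.range (m + 1)).image (Nat.pair m)

theorem card_blockGroup (m : ℕ) : (blockGroup m).card = m + 1 := by
  rw [blockGroup, Finset.card_image_of_injective, Finset.card_range]
  intro i j h
  exact (Nat.pair_eq_pair.1 h).2

theorem blockGroup_nonempty (m : ℕ) : (blockGroup m).Nonempty := by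
  rw [← Finset.card_pos, card_blockGroup]
  omega

theorem eq_of_mem_blockGroup {m n j : ℕ} (hm : j ∈ blockGroup m) (hn : j ∈ blockGroup n) :
    m = n := by
  simp only [blockGroup, Finset.mem_image] at hm hn
  obtain ⟨a, _, rfl⟩ := hm
  obtain ⟨b, _, h⟩ := hn
  exact (Nat.pair_eq_pair.1 h).1.symm

/-- The subsets of `blockGroup m` other than the empty and the full one. -/
def properSubsets (m : ℕ) : Finset (Finset ℕ) :=
  ((blockGroup m).powerset.erase ∅).erase (blockGroup m)

theorem mem_properSubsets {m : ℕ} {S : Finset ℕ} :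
    S ∈ properSubsets m ↔ S ≠ blockGroup m ∧ S ≠ ∅ ∧ S ⊆ blockGroup m := by
  simp [properSubsets]

theorem card_properSubsets_le (m : ℕ) : (properSubsets m).card ≤ 2 ^ (m + 1) := by
  refine (Finset.card_le_card
    ((Finset.erase_subset _ _).trans (Finset.erase_subset _ _))).trans_eq ?_
  rw [Finset.card_powerset, card_blockGroup]

theorem sum_powerset_blockGroup (m : ℕ) (F : Finset ℕ → ℂ) :
    ∑ S ∈ (blockGroup m).powerset, F S
      = F ∅ + (F (blockGroup m) + ∑ S ∈ properSubsets m, F S) := by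
  rw [properSubsets, Finset.add_sum_erase, Finset.add_sum_erase]
  · simp
  · simp [(blockGroup_nonempty m).ne_empty]

theorem sdiff_mem_properSubsets {m : ℕ} {S : Finset ℕ} (hS : S ∈ properSubsets m) :
    blockGroup m \ S ∈ properSubsets m := by
  rw [mem_properSubsets] at hS ⊢
  obtain ⟨h1, h2, h3⟩ := hS
  refine ⟨fun h => h2 ?_, fun h => h1 ?_, Finset.sdiff_subset⟩
  · rw [Finset.sdiff_eq_self_iff_disjoint] at h
    exact Finset.disjoint_self_iff_empty _ |>.1 (h.mono_left h3)
  · rw [Finset.sdiff_eq_empty_iff_subset] at h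
    exact Finset.Subset.antisymm h3 h

variable (d : ℕ) (r : ℝ)

/-- The symbol `∑ r ^ m Φ_m`, where `Φ_m` is the product of the block forms in the `m`-th group. -/
def symbol : L2 := ∑' m : ℕ, ((r ^ m : ℝ) : ℂ) • polyL2 (blockProd d (blockGroup m))

variable {d r}

theorem norm_polyL2_blockProd (hd : 0 < d) (S : Finset ℕ) : ‖polyL2 (blockProd d S)‖ = 1 := by
  rw [@norm_eq_sqrt_re_inner ℂ, inner_blockProd_blockProd hd, if_pos rfl]
  simp

theorem hasSum_symbol (hd : 0 < d) (h0 : 0 ≤ r) (h1 : r < 1) :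
    HasSum (fun m : ℕ => ((r ^ m : ℝ) : ℂ) • polyL2 (blockProd d (blockGroup m))) (symbol d r) := by
  refine Summable.hasSum (Summable.of_norm ?_)
  refine (summable_geometric_of_lt_one h0 h1).congr fun m => ?_
  rw [norm_smul, norm_polyL2_blockProd hd, mul_one, Complex.norm_real, Real.norm_eq_abs,
    abs_of_nonneg (by positivity)]

theorem hasSum_inner_symbol (hd : 0 < d) (h0 : 0 ≤ r) (h1 : r < 1) (x : L2) :
    HasSum (fun m : ℕ => ((r ^ m : ℝ) : ℂ) * inner ℂ (polyL2 (blockProd d (blockGroup m))) x)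
      (inner ℂ (symbol d r) x) := by
  have h := (hasSum_symbol hd h0 h1).mapL (innerSL ℂ x)
  rw [← RCLike.hasSum_conj'] at h
  simpa [inner_smul_right, inner_conj_symm] using h

theorem symbol_mem_hardy (hd : 0 < d) (h0 : 0 ≤ r) (h1 : r < 1) : symbol d r ∈ hardy := by
  refine (Submodule.isClosed_topologicalClosure _).mem_of_tendsto (hasSum_symbol hd h0 h1)
    (Filter.Eventually.of_forall fun A => Submodule.sum_mem _ fun m _ => Submodule.smul_mem _ _ ?_)
  exact Submodule.le_topologicalClosure _ (LinearMap.mem_range_self polyL2 _)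

theorem inner_symbol_blockProd (hd : 0 < d) (h0 : 0 ≤ r) (h1 : r < 1) (m : ℕ) :
    inner ℂ (symbol d r) (polyL2 (blockProd d (blockGroup m))) = ((r ^ m : ℝ) : ℂ) := by
  refine (hasSum_inner_symbol hd h0 h1 _).unique ?_
  have h := hasSum_single (f := fun k : ℕ => ((r ^ k : ℝ) : ℂ) *
    inner ℂ (polyL2 (blockProd d (blockGroup k))) (polyL2 (blockProd d (blockGroup m)))) m ?_
  · simpa [inner_blockProd_blockProd hd, norm_polyL2_blockProd hd] using h
  · intro k hk
    rw [inner_blockProd_blockProd hd, if_neg, mul_zero]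
    intro h
    obtain ⟨j, hj⟩ := blockGroup_nonempty k
    exact hk (eq_of_mem_blockGroup hj (h ▸ hj))

theorem inner_symbol_blockProd_of_ne (hd : 0 < d) (h0 : 0 ≤ r) (h1 : r < 1) {S : Finset ℕ}
    (hS : ∀ m, S ≠ blockGroup m) : inner ℂ (symbol d r) (polyL2 (blockProd d S)) = 0 := by
  refine (hasSum_inner_symbol hd h0 h1 _).unique ?_
  simp [inner_blockProd_blockProd hd, fun m => (hS m).symm]

theorem norm_symbol_pos (hd : 0 < d) (h0 : 0 ≤ r) (h1 : r < 1) : 0 < ‖symbol d r‖ := by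
  rw [norm_pos_iff]
  intro h
  have := inner_symbol_blockProd hd h0 h1 0
  simp [h] at this

end Symbol

/-! ### The singular system of the Hankel operator -/

section SchattenMembership

/-- The index set of the singular system of `H_φ` for `φ = symbol d r`. The two elements of `Bool`
stand for the constant function and the normalized symbol, which all groups of blocks share; the
other indices are the proper subsets of the groups. -/
abbrev SingularIndex : Type := Bool ⊕ Σ m : ℕ, properSubsets m

/-- The involution that passes to the complementary subset within the group. It exchanges the
constant function, where no block form occurs, with the symbol. -/
def SingularIndex.swap : SingularIndex → SingularIndex
  | .inl b => .inl !b
  | .inr ⟨m, S⟩ => .inr ⟨m, ⟨blockGroup m \ S, sdiff_mem_properSubsets S.2⟩⟩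

theorem SingularIndex.swap_involutive : Function.Involutive SingularIndex.swap := by
  rintro (b | ⟨m, S, hS⟩)
  · simp [SingularIndex.swap]
  · have h := (mem_properSubsets.1 hS).2.2
    simp [SingularIndex.swap, Finset.inter_eq_right.2 h]

variable (d : ℕ) (r : ℝ)

/-- The right singular vectors of the Hankel operator. The left singular vector with index `i` is
the complex conjugate of the right singular vector with index `i.swap`. -/
def singularVector : SingularIndex → L2
  | .inl false => polyL2 (blockProd d ∅)
  | .inl true => ((‖symbol d r‖⁻¹ : ℝ) : ℂ) • symbol d r
  | .inr ⟨_, S⟩ => polyL2 (blockProd d S)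

/-- The singular values of the Hankel operator. -/
def singularWeight : SingularIndex → ℝ
  | .inl _ => ‖symbol d r‖
  | .inr ⟨m, _⟩ => r ^ m

variable {d r}

theorem ne_blockGroup_of_mem_properSubsets {m n : ℕ} {S : Finset ℕ} (hS : S ∈ properSubsets m) :
    S ≠ blockGroup n := by
  rintro rfl
  obtain ⟨h1, -, h3⟩ := mem_properSubsets.1 hS
  obtain ⟨j, hj⟩ := blockGroup_nonempty n
  exact h1 (by rw [eq_of_mem_blockGroup hj (h3 hj)])

theorem eq_of_mem_properSubsets {m n : ℕ} {S : Finset ℕ} (hm : S ∈ properSubsets m)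
    (hn : S ∈ properSubsets n) : m = n := by
  obtain ⟨-, h2, h3⟩ := mem_properSubsets.1 hm
  obtain ⟨j, hj⟩ := Finset.nonempty_iff_ne_empty.2 h2
  exact eq_of_mem_blockGroup (h3 hj) ((mem_properSubsets.1 hn).2.2 hj)

theorem orthonormal_singularVector (hd : 0 < d) (h0 : 0 ≤ r) (h1 : r < 1) :
    Orthonormal ℂ (singularVector d r) := by
  have hpos := norm_symbol_pos hd h0 h1
  have hempty : inner ℂ (symbol d r) (polyL2 (blockProd d ∅)) = 0 :=
    inner_symbol_blockProd_of_ne hd h0 h1 fun m h => (blockGroup_nonempty m).ne_empty h.symm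
  have hprop : ∀ m, ∀ S ∈ properSubsets m, inner ℂ (symbol d r) (polyL2 (blockProd d S)) = 0 :=
    fun m S hS => inner_symbol_blockProd_of_ne hd h0 h1 fun n =>
      ne_blockGroup_of_mem_properSubsets hS
  refine ⟨?_, ?_⟩
  · rintro ((_ | _) | ⟨m, S⟩)
    · exact norm_polyL2_blockProd hd _
    · rw [singularVector, norm_smul, Complex.norm_real, norm_inv, norm_norm,
        inv_mul_cancel₀ hpos.ne']
    · exact norm_polyL2_blockProd hd _
  · rintro ((_ | _) | ⟨m, S⟩) ((_ | _) | ⟨n, T⟩) hne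
    · exact absurd rfl hne
    · rw [singularVector, singularVector, inner_smul_right, ← inner_conj_symm, hempty, map_zero,
        mul_zero]
    · rw [singularVector, singularVector, inner_blockProd_blockProd hd, if_neg]
      exact ((mem_properSubsets.1 T.2).2.1).symm
    · rw [singularVector, singularVector, inner_smul_left, hempty, mul_zero]
    · exact absurd rfl hne
    · rw [singularVector, singularVector, inner_smul_left, hprop n T T.2, mul_zero]
    · rw [singularVector, singularVector, inner_blockProd_blockProd hd, if_neg]
      exact (mem_properSubsets.1 S.2).2.1
    · rw [singularVector, singularVector, inner_smul_right, ← inner_conj_symm, hprop m S S.2,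
        map_zero, mul_zero]
    · rw [singularVector, singularVector, inner_blockProd_blockProd hd, if_neg]
      obtain ⟨S, hS⟩ := S
      obtain ⟨T, hT⟩ := T
      rintro (rfl : S = T)
      obtain rfl := eq_of_mem_properSubsets hS hT
      exact hne rfl

theorem singularVector_mem_hardy (hd : 0 < d) (h0 : 0 ≤ r) (h1 : r < 1) (i : SingularIndex) :
    singularVector d r i ∈ hardy := by
  have hpoly : ∀ f, polyL2 f ∈ hardy := fun f => (polyHardy f).2
  rcases i with ((_ | _) | ⟨m, S⟩)
  · exact hpoly _
  · exact hardy.smul_mem _ (symbol_mem_hardy hd h0 h1)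
  · exact hpoly _

theorem singularWeight_pos (hd : 0 < d) (h0 : 0 < r) (h1 : r < 1) (i : SingularIndex) :
    0 < singularWeight d r i := by
  rcases i with (_ | ⟨m, S⟩)
  · exact norm_symbol_pos hd h0.le h1
  · exact pow_pos h0 m

/-- The `m`-th group contributes fewer than `2 ^ (m + 1)` singular values `r ^ m`. -/
theorem summable_singularWeight_rpow (h0 : 0 < r) {p : ℝ} (hp : 2 * r ^ p < 1) :
    Summable fun i => singularWeight d r i ^ p := by
  refine Summable.sum _ (Summable.of_finite) ?_
  have hnn : 0 ≤ r ^ p := Real.rpow_nonneg h0.le p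
  have hpow : ∀ m : ℕ, (r ^ m) ^ p = (r ^ p) ^ m := fun m => by
    rw [← Real.rpow_natCast, ← Real.rpow_mul h0.le, mul_comm, Real.rpow_mul h0.le,
      Real.rpow_natCast]
  refine (summable_sigma_of_nonneg fun x => ?_).2 ⟨fun m => Summable.of_finite, ?_⟩
  · exact Real.rpow_nonneg (pow_nonneg h0.le _) p
  · refine Summable.of_nonneg_of_le (fun m => ?_) (fun m => ?_)
      ((summable_geometric_of_lt_one (by positivity) hp).mul_left 2)
    · exact tsum_nonneg fun _ => Real.rpow_nonneg (pow_nonneg h0.le _) p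
    · change ∑' _ : properSubsets m, (r ^ m) ^ p ≤ _
      rw [tsum_const, nsmul_eq_mul, hpow, Nat.card_eq_fintype_card, Fintype.card_coe]
      have h2 : ((properSubsets m).card : ℝ) ≤ 2 ^ (m + 1) := by
        exact_mod_cast card_properSubsets_le m
      calc ((properSubsets m).card : ℝ) * (r ^ p) ^ m ≤ 2 ^ (m + 1) * (r ^ p) ^ m := by gcongr
        _ = 2 * (2 * r ^ p) ^ m := by rw [mul_pow]; ring

/-- The bilinear form of the singular value expansion is the Hankel form. In the coproduct formula
for each group, the empty and the full subset add up to the two terms that involve the symbol. -/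
theorem tsum_singular_expansion (hd : 0 < d) (h0 : 0 < r) (h1 : r < 1)
    (f g : MvPolynomial ℕ ℂ)
    (hsum : Summable fun i => (singularWeight d r i : ℂ) *
      inner ℂ (singularVector d r i) (polyL2 f) *
        inner ℂ (singularVector d r i.swap) (polyL2 g)) :
    ∑' i, (singularWeight d r i : ℂ) * inner ℂ (singularVector d r i) (polyL2 f) *
        inner ℂ (singularVector d r i.swap) (polyL2 g)
      = inner ℂ (symbol d r) (polyL2 (f * g)) := by
  have hpos : (‖symbol d r‖ : ℂ) ≠ 0 := by exact_mod_cast (norm_symbol_pos hd h0.le h1).ne'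
  have hinr := hsum.comp_injective (Sum.inr_injective (α := Bool))
  rw [Summable.tsum_sum Summable.of_finite hinr, tsum_bool]
  have hf := hasSum_inner_symbol hd h0.le h1 (polyL2 f)
  have hg := hasSum_inner_symbol hd h0.le h1 (polyL2 g)
  have hfg := hasSum_inner_symbol hd h0.le h1 (polyL2 (f * g))
  have hrest := hinr.hasSum.sigma fun m => (hinr.sigma_factor m).hasSum
  have hall := ((hg.mul_left (inner ℂ (polyL2 (blockProd d ∅)) (polyL2 f))).add
    (hf.mul_right (inner ℂ (polyL2 (blockProd d ∅)) (polyL2 g)))).add hrest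
  have hterm : ∀ m : ℕ, ((r ^ m : ℝ) : ℂ) *
      inner ℂ (polyL2 (blockProd d (blockGroup m))) (polyL2 (f * g)) =
      inner ℂ (polyL2 (blockProd d ∅)) (polyL2 f) *
        (((r ^ m : ℝ) : ℂ) * inner ℂ (polyL2 (blockProd d (blockGroup m))) (polyL2 g)) +
      ((r ^ m : ℝ) : ℂ) * inner ℂ (polyL2 (blockProd d (blockGroup m))) (polyL2 f) *
        inner ℂ (polyL2 (blockProd d ∅)) (polyL2 g) +
      ∑' S : properSubsets m, ((r ^ m : ℝ) : ℂ) *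
        inner ℂ (polyL2 (blockProd d S)) (polyL2 f) *
        inner ℂ (polyL2 (blockProd d (blockGroup m \ S))) (polyL2 g) := by
    intro m
    rw [inner_blockProd_mul hd, sum_powerset_blockGroup, tsum_fintype,
      Finset.sum_coe_sort (properSubsets m) (fun S => ((r ^ m : ℝ) : ℂ) *
        inner ℂ (polyL2 (blockProd d S)) (polyL2 f) *
        inner ℂ (polyL2 (blockProd d (blockGroup m \ S))) (polyL2 g)),
      Finset.sdiff_empty, Finset.sdiff_self, mul_add, mul_add, Finset.mul_sum]
    simp only [mul_assoc]
    ring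
  have huniq := hfg.unique (hall.congr_fun hterm)
  rw [huniq]
  simp only [SingularIndex.swap, singularVector, singularWeight, Bool.not_false, Bool.not_true,
    inner_smul_left, Complex.conj_ofReal, Function.comp_def]
  push_cast
  field_simp

theorem hankelInSchatten_symbol (hd : 0 < d) (h0 : 0 < r) (h1 : r < 1) {p : ℝ} (hp0 : 0 < p)
    (hp : 2 * r ^ p < 1) : HankelInSchatten p (symbol d r) := by
  let e : SingularIndex → hardy := fun i =>
    ⟨singularVector d r i, singularVector_mem_hardy hd h0.le h1 i⟩
  have he : Orthonormal ℂ e := (orthonormal_singularVector hd h0.le h1).codRestrict _ _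
  have hf : Orthonormal ℂ fun i : SingularIndex => conjHardy (e i.swap) := by
    have h2 := he.comp _ SingularIndex.swap_involutive.injective
    rw [orthonormal_iff_ite] at h2 ⊢
    intro i j
    refine (inner_conjHardy _ _).trans ((h2 j i).trans ?_)
    simp only [eq_comm]
  obtain ⟨T, hT, hsum⟩ := exists_isSchatten he hf (singularWeight_pos hd h0 h1) hp0
    (summable_singularWeight_rpow h0 hp)
  refine ⟨T, fun f => antiHardy_ext fun g => ?_, hT⟩
  rw [inner_conjHardy_hankelOpPoly]
  have h2 := (hsum (polyHardy f)).mapL (innerSL ℂ (conjHardy (polyHardy g)))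
  simp only [innerSL_apply_apply, inner_smul_right, inner_conjHardy] at h2
  have h3 : HasSum (fun i => (singularWeight d r i : ℂ) *
      inner ℂ (singularVector d r i) (polyL2 f) *
        inner ℂ (singularVector d r i.swap) (polyL2 g))
      (inner ℂ (conjHardy (polyHardy g)) (T (polyHardy f))) := h2
  rw [← tsum_singular_expansion hd h0 h1 f g h3.summable, h3.tsum_eq]

end SchattenMembership

/-! ### Absolute first moments under convergence in distribution -/

section AbsoluteMoments

open Filter Topology ProbabilityTheory

theorem integral_abs_gaussianReal : ∫ x, |x| ∂(gaussianReal 0 1) = 2 / √(2 * Real.pi) := by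
  rw [integral_gaussianReal_eq_integral_smul one_ne_zero]
  have h1 : ∀ x : ℝ, gaussianPDFReal 0 1 x • |x|
      = (√(2 * Real.pi))⁻¹ * (|x| * Real.exp (-|x| ^ 2 / 2)) := by
    intro x
    rw [gaussianPDFReal, sq_abs]
    simp
    ring
  have h2 : ∫ x in Set.Ioi (0 : ℝ), x * Real.exp (-x ^ 2 / 2) = 1 := by
    have h := integral_rpow_mul_exp_neg_mul_rpow (p := 2) (q := 1) (b := 1 / 2)
      (by norm_num) (by norm_num) (by norm_num)
    have h3 : ∀ x : ℝ, x ^ (1 : ℝ) * Real.exp (-(1 / 2) * x ^ (2 : ℝ))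
        = x * Real.exp (-x ^ 2 / 2) := by
      intro x
      rw [Real.rpow_one, Real.rpow_two]
      congr 2
      ring
    simp only [h3] at h
    rw [h]
    norm_num [Real.rpow_neg_one]
  simp only [h1]
  rw [integral_const_mul, integral_comp_abs (f := fun x => x * Real.exp (-x ^ 2 / 2)), h2]
  ring

/-- Convergence in distribution controls the truncations `min |X n| M`; the second moments control
the remainder. -/
theorem eventually_integral_abs_lt {Ω Ω' : Type*} [MeasurableSpace Ω] [MeasurableSpace Ω']
    {P : Measure Ω} [IsProbabilityMeasure P] {P' : Measure Ω'} [IsProbabilityMeasure P']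
    {X : ℕ → Ω → ℝ} {Y : Ω' → ℝ}
    (h : TendstoInDistribution X atTop Y (fun _ => P) P')
    (hX : ∀ n, MemLp (X n) 2 P) {C : ℝ} (hC : 0 < C)
    (hX2 : ∀ n, ∫ ω, X n ω ^ 2 ∂P ≤ C) (hY : Integrable Y P')
    {ε : ℝ} (hε : 0 < ε) :
    ∀ᶠ n in atTop, ∫ ω, |X n ω| ∂P < (∫ ω, |Y ω| ∂P') + ε := by
  set M : ℝ := 2 * C / ε with hM
  have hMpos : 0 < M := by positivity
  let g : BoundedContinuousFunction ℝ ℝ :=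
    BoundedContinuousFunction.ofNormedAddCommGroup (fun x => min |x| M)
      (by fun_prop) M (by
        intro x
        rw [Real.norm_eq_abs, abs_of_nonneg (le_min (abs_nonneg _) hMpos.le)]
        exact min_le_right _ _)
  have hg := ProbabilityMeasure.tendsto_iff_forall_integral_tendsto.1 h.tendsto g
  have hg1 : ∀ n, ∫ x, g x ∂(P.map (X n)) = ∫ ω, min |X n ω| M ∂P := fun n =>
    integral_map (h.forall_aemeasurable n) g.continuous.aestronglyMeasurable
  have hg2 : ∫ x, g x ∂(P'.map Y) = ∫ ω, min |Y ω| M ∂P' :=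
    integral_map h.aemeasurable_limit g.continuous.aestronglyMeasurable
  simp only [ProbabilityMeasure.coe_mk, hg1, hg2] at hg
  have hle : ∫ ω, min |Y ω| M ∂P' ≤ ∫ ω, |Y ω| ∂P' :=
    integral_mono_of_nonneg (Eventually.of_forall fun ω => le_min (abs_nonneg _) hMpos.le)
      hY.abs (Eventually.of_forall fun ω => min_le_left _ _)
  have hev := hg.eventually_lt_const (show ∫ ω, min |Y ω| M ∂P' < (∫ ω, |Y ω| ∂P') + ε / 2 by
    linarith)
  filter_upwards [hev] with n hn
  have hXi : Integrable (X n) P := (hX n).integrable (by norm_num)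
  have hmin : Integrable (fun ω => min |X n ω| M) P := hXi.abs.inf (integrable_const M)
  have hsq : Integrable (fun ω => X n ω ^ 2) P := (hX n).integrable_sq
  -- Where `|X n| > M`, the second summand alone dominates `|X n|`.
  have hpt : ∀ ω, |X n ω| ≤ min |X n ω| M + X n ω ^ 2 / M := by
    intro ω
    rcases le_total |X n ω| M with h1 | h1
    · rw [min_eq_left h1]
      have : 0 ≤ X n ω ^ 2 / M := by positivity
      linarith
    · have : |X n ω| ≤ X n ω ^ 2 / M := by
        rw [le_div_iff₀ hMpos, ← sq_abs, sq]
        gcongr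
      have h2 : 0 ≤ min |X n ω| M := le_min (abs_nonneg _) hMpos.le
      linarith
  have hint : ∫ ω, |X n ω| ∂P ≤ (∫ ω, min |X n ω| M ∂P) + (∫ ω, X n ω ^ 2 ∂P) / M := by
    rw [← integral_div, ← integral_add hmin (hsq.div_const M)]
    exact integral_mono hXi.abs (hmin.add (hsq.div_const M)) hpt
  have hM2 : (∫ ω, X n ω ^ 2 ∂P) / M ≤ ε / 2 := by
    rw [div_le_iff₀ hMpos, hM]
    have : ε / 2 * (2 * C / ε) = C := by field_simp
    rw [this]
    exact hX2 n
  linarith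

end AbsoluteMoments

/-! ### First moments by rotation invariance -/

section Rotation

open Real in
theorem integral_abs_re_toCircle :
    ∫ t : UnitAddCircle, |(AddCircle.toCircle t : ℂ).re| ∂AddCircle.haarAddCircle = 2 / π := by
  rw [AddCircle.integral_haarAddCircle, inv_one, one_smul,
    ← UnitAddCircle.intervalIntegral_preimage (-(1 / 4))]
  have h1 : ∀ x : ℝ, |(AddCircle.toCircle (x : UnitAddCircle) : ℂ).re| = |cos (2 * π * x)| := by
    intro x
    rw [AddCircle.toCircle_apply_mk, Circle.coe_exp, Complex.exp_ofReal_mul_I_re, div_one]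
  simp only [h1]
  have hcont : Continuous fun x : ℝ => |cos (2 * π * x)| := by fun_prop
  have hd : ∀ x : ℝ, HasDerivAt (fun x => sin (2 * π * x) / (2 * π)) (cos (2 * π * x)) x := by
    intro x
    have h := ((hasDerivAt_id x).const_mul (2 * π)).sin.div_const (2 * π)
    refine h.congr_deriv ?_
    simp only [id_eq, mul_one]
    exact mul_div_cancel_right₀ _ (by positivity)
  have hi : ∀ a b : ℝ, IntervalIntegrable (fun x : ℝ => cos (2 * π * x)) volume a b := fun a b =>
    Continuous.intervalIntegrable (by fun_prop) _ _
  rw [← intervalIntegral.integral_add_adjacent_intervals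
    (hcont.intervalIntegrable _ (1 / 4)) (hcont.intervalIntegrable (1 / 4) _)]
  -- The cosine is nonnegative on the first half of the period and nonpositive on the second.
  have e1 : ∫ x in (-(1 / 4) : ℝ)..1 / 4, |cos (2 * π * x)|
      = ∫ x in (-(1 / 4) : ℝ)..1 / 4, cos (2 * π * x) := by
    refine intervalIntegral.integral_congr fun x hx => ?_
    rw [Set.uIcc_of_le (by norm_num)] at hx
    refine abs_of_nonneg (cos_nonneg_of_mem_Icc ⟨?_, ?_⟩)
    · nlinarith [hx.1, pi_pos]
    · nlinarith [hx.2, pi_pos]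
  have e2 : ∫ x in (1 / 4 : ℝ)..(-(1 / 4) + 1), |cos (2 * π * x)|
      = ∫ x in (1 / 4 : ℝ)..(-(1 / 4) + 1), -cos (2 * π * x) := by
    refine intervalIntegral.integral_congr fun x hx => ?_
    rw [Set.uIcc_of_le (by norm_num)] at hx
    refine abs_of_nonpos (cos_nonpos_of_pi_div_two_le_of_le ?_ ?_)
    · nlinarith [hx.1, pi_pos]
    · nlinarith [hx.2, pi_pos]
  rw [e1, e2, intervalIntegral.integral_neg,
    intervalIntegral.integral_eq_sub_of_hasDerivAt (fun x _ => hd x) (hi _ _),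
    intervalIntegral.integral_eq_sub_of_hasDerivAt (fun x _ => hd x) (hi _ _)]
  have s1 : sin (2 * π * (1 / 4)) = 1 := by
    rw [show 2 * π * (1 / 4) = π / 2 by ring, sin_pi_div_two]
  have s2 : sin (2 * π * (-(1 / 4))) = -1 := by
    rw [show 2 * π * (-(1 / 4)) = -(π / 2) by ring, sin_neg, sin_pi_div_two]
  have s3 : sin (2 * π * (-(1 / 4) + 1)) = -1 := by
    rw [show 2 * π * (-(1 / 4) + 1) = π / 2 + π by ring, sin_add_pi, sin_pi_div_two]
  rw [s1, s2, s3]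
  field_simp
  norm_num

theorem integral_abs_re_toCircle_mul (z : ℂ) :
    ∫ t : UnitAddCircle, |((AddCircle.toCircle t : ℂ) * z).re| ∂AddCircle.haarAddCircle
      = 2 / Real.pi * ‖z‖ := by
  by_cases hz : z = 0
  · simp [hz]
  have hn : ‖z‖ ≠ 0 := norm_ne_zero_iff.2 hz
  obtain ⟨s, hs⟩ : ∃ s : UnitAddCircle, (AddCircle.toCircle s : ℂ) = z / ‖z‖ := by
    obtain ⟨s, hs⟩ := (AddCircle.homeomorphCircle (T := (1 : ℝ)) one_ne_zero).surjective
      ⟨z / ‖z‖, by simp [Submonoid.unitSphere, hn]⟩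
    refine ⟨s, ?_⟩
    rw [AddCircle.homeomorphCircle_apply] at hs
    rw [hs]
  have h1 : ∀ t : UnitAddCircle, |((AddCircle.toCircle t : ℂ) * z).re|
      = |(AddCircle.toCircle (t + s) : ℂ).re| * ‖z‖ := by
    intro t
    rw [AddCircle.toCircle_add, Circle.coe_mul, hs]
    have h2 : (AddCircle.toCircle t : ℂ) * z
        = ((AddCircle.toCircle t : ℂ) * (z / ‖z‖)) * (‖z‖ : ℝ) := by
      have : (‖z‖ : ℂ) ≠ 0 := by exact_mod_cast hn
      field_simp
    rw [h2, Complex.re_mul_ofReal, abs_mul, abs_norm]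
  simp only [h1]
  rw [integral_mul_const, integral_add_right_eq_self
    (fun t : UnitAddCircle => |(AddCircle.toCircle t : ℂ).re|) s, integral_abs_re_toCircle]

theorem polyFun_blockForm (d j : ℕ) (θ : Polytorus) :
    polyFun (blockForm d j) θ
      = (((√d)⁻¹ : ℝ) : ℂ) * ∑ i ∈ Finset.range d, coord θ (d * j + i) := by
  simp [polyFun, blockForm]

theorem polyFun_blockForm_add_const (d j : ℕ) (t : UnitAddCircle) (θ : Polytorus) :
    polyFun (blockForm d j) (fun i => θ i + t)
      = (AddCircle.toCircle t : ℂ) * polyFun (blockForm d j) θ := by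
  rw [polyFun_blockForm, polyFun_blockForm]
  simp only [coord, AddCircle.toCircle_add, Circle.coe_mul]
  rw [← Finset.sum_mul]
  ring

/-- A common rotation of all variables multiplies the block form by a number of modulus one.
Averaging `|Re|` over these rotations gives `2 / π` times the modulus. -/
theorem integral_norm_blockForm_eq (d j : ℕ) :
    ∫ θ, ‖polyFun (blockForm d j) θ‖ ∂haar
      = Real.pi / 2 * ∫ θ, |(polyFun (blockForm d j) θ).re| ∂haar := by
  have hZ := continuous_polyFun (blockForm d j)
  have hcirc : Continuous fun t : UnitAddCircle => (AddCircle.toCircle t : ℂ) :=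
    continuous_subtype_val.comp AddCircle.continuous_toCircle
  have hF : Continuous fun q : UnitAddCircle × Polytorus =>
      |((AddCircle.toCircle q.1 : ℂ) * polyFun (blockForm d j) q.2).re| :=
    (Complex.continuous_re.comp
      ((hcirc.comp continuous_fst).mul (hZ.comp continuous_snd))).abs
  have hint : Integrable (fun q : UnitAddCircle × Polytorus =>
      |((AddCircle.toCircle q.1 : ℂ) * polyFun (blockForm d j) q.2).re|)
      (AddCircle.haarAddCircle.prod haar) := by
    obtain ⟨C, hC⟩ := isCompact_univ.exists_bound_of_continuousOn hF.continuousOn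
    exact Integrable.of_bound hF.aestronglyMeasurable C
      (Filter.Eventually.of_forall fun q => hC q (Set.mem_univ q))
  have h1 : ∀ t : UnitAddCircle,
      ∫ θ, |((AddCircle.toCircle t : ℂ) * polyFun (blockForm d j) θ).re| ∂haar
        = ∫ θ, |(polyFun (blockForm d j) θ).re| ∂haar := by
    intro t
    have hc : Continuous fun θ => |(polyFun (blockForm d j) θ).re| :=
      (Complex.continuous_re.comp hZ).abs
    rw [← integral_haar_add hc fun _ => t]
    simp only [polyFun_blockForm_add_const]
  have h2 := integral_integral_swap (f := fun (t : UnitAddCircle) (θ : Polytorus) =>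
    |((AddCircle.toCircle t : ℂ) * polyFun (blockForm d j) θ).re|) hint
  simp only [h1, integral_abs_re_toCircle_mul, integral_const, probReal_univ, one_smul,
    integral_const_mul] at h2
  rw [h2]
  field_simp

end Rotation

/-! ### The mean modulus of a block form -/

section BlockMean

open Filter Topology ProbabilityTheory

/-- The mean modulus of a block form, which does not depend on the block, see
`integral_norm_blockForm`. -/
def blockMean (d : ℕ) : ℝ := ∫ θ, ‖polyFun (blockForm d 0) θ‖ ∂haar

/-- The real part of a coordinate, scaled to variance one. -/
def scaledRe (x : UnitAddCircle) : ℝ := √2 * (AddCircle.toCircle x : ℂ).re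

theorem continuous_scaledRe : Continuous scaledRe :=
  continuous_const.mul (Complex.continuous_re.comp
    (continuous_subtype_val.comp AddCircle.continuous_toCircle))

theorem integral_coord_pow (k : ℕ) {n : ℕ} (hn : n ≠ 0) : ∫ θ, coord θ k ^ n ∂haar = 0 := by
  have h := inner_polyL2_monomial 0 (Finsupp.single k n)
  rw [if_neg (Ne.symm (by simpa using hn)), inner_polyL2] at h
  simpa [polyFun, MvPolynomial.aeval_monomial] using h

theorem integrable_of_continuous {E : Type*} [NormedAddCommGroup E]
    [SecondCountableTopologyEither Polytorus E] {f : Polytorus → E}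
    (hf : Continuous f) : Integrable f haar := by
  obtain ⟨C, hC⟩ := isCompact_univ.exists_bound_of_continuousOn hf.continuousOn
  exact Integrable.of_bound hf.aestronglyMeasurable C
    (Filter.Eventually.of_forall fun q => hC q (Set.mem_univ q))

theorem integral_re_coord_pow (k : ℕ) {n : ℕ} (hn : n ≠ 0) :
    ∫ θ, (coord θ k ^ n).re ∂haar = 0 := by
  have hc : Continuous fun θ => coord θ k ^ n := (continuous_coord k).pow n
  have h := integral_re (𝕜 := ℂ) (integrable_of_continuous hc)
  rw [integral_coord_pow k hn] at h
  simpa using h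

theorem integral_scaledRe : ∫ θ : Polytorus, scaledRe (θ 0) ∂haar = 0 := by
  have h := integral_re_coord_pow 0 one_ne_zero
  simp only [pow_one] at h
  change ∫ θ : Polytorus, √2 * (coord θ 0).re ∂haar = 0
  rw [integral_const_mul, h, mul_zero]

theorem integral_scaledRe_sq : ∫ θ : Polytorus, scaledRe (θ 0) ^ 2 ∂haar = 1 := by
  have hc : Continuous fun θ => (coord θ 0 ^ 2).re :=
    Complex.continuous_re.comp ((continuous_coord 0).pow 2)
  have h : ∀ θ : Polytorus, scaledRe (θ 0) ^ 2 = 1 + (coord θ 0 ^ 2).re := by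
    intro θ
    change (√2 * (coord θ 0).re) ^ 2 = _
    have h1 : (coord θ 0).re ^ 2 + (coord θ 0).im ^ 2 = 1 := by
      have h2 : ‖coord θ 0‖ ^ 2 = 1 := by rw [coord, norm_toCircle, one_pow]
      rw [← h2, ← Complex.normSq_eq_norm_sq, Complex.normSq_apply]
      ring
    rw [mul_pow, Real.sq_sqrt (by norm_num), sq (coord θ 0), Complex.mul_re]
    linarith
  simp only [h]
  rw [integral_add (integrable_const _) (integrable_of_continuous hc),
    integral_re_coord_pow 0 two_ne_zero]
  simp

theorem scaledRe_sum_eq (n : ℕ) (θ : Polytorus) :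
    (√n)⁻¹ * ∑ k ∈ Finset.range n, scaledRe (θ k) = √2 * (polyFun (blockForm n 0) θ).re := by
  rw [polyFun_blockForm, Complex.re_ofReal_mul, Complex.re_sum]
  simp only [mul_zero, zero_add, scaledRe, coord]
  rw [← Finset.mul_sum]
  ring

theorem integral_norm_blockForm_sq {d : ℕ} (hd : 0 < d) :
    ∫ θ, ‖polyFun (blockForm d 0) θ‖ ^ 2 ∂haar = 1 := by
  have h := inner_blockProd_blockProd hd {0} {0}
  rw [if_pos rfl, inner_polyL2, blockProd, Finset.prod_singleton] at h
  have h2 : ∀ θ, polyFun (blockForm d 0) θ * conj (polyFun (blockForm d 0) θ)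
      = ((‖polyFun (blockForm d 0) θ‖ ^ 2 : ℝ) : ℂ) := by
    intro θ
    rw [Complex.mul_conj, Complex.normSq_eq_norm_sq]
  simp only [h2] at h
  rw [integral_complex_ofReal] at h
  exact_mod_cast h

theorem identDistrib_scaledRe (i : ℕ) :
    IdentDistrib (fun θ : Polytorus => scaledRe (θ i)) (fun θ => scaledRe (θ 0)) haar haar := by
  have h : IdentDistrib (fun θ : Polytorus => θ i) (fun θ : Polytorus => θ 0) haar haar := by
    refine ⟨(measurable_pi_apply i).aemeasurable, (measurable_pi_apply 0).aemeasurable, ?_⟩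
    rw [haar, Measure.infinitePi_map_eval, Measure.infinitePi_map_eval]
  exact h.comp continuous_scaledRe.measurable

/-- The central limit theorem for the real parts of the coordinates. -/
theorem tendstoInDistribution_blockForm :
    TendstoInDistribution (fun (n : ℕ) (θ : Polytorus) => √2 * (polyFun (blockForm n 0) θ).re)
      atTop id (fun _ => haar) (gaussianReal 0 1) := by
  have h := tendstoInDistribution_inv_sqrt_mul_sum (P := haar) (P' := gaussianReal 0 1)
    (X := fun k (θ : Polytorus) => scaledRe (θ k)) (Y := id) HasLaw.id
    integral_scaledRe integral_scaledRe_sq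
    (iIndepFun_infinitePi (X := fun _ x => scaledRe x) fun _ => continuous_scaledRe.measurable)
    identDistrib_scaledRe
  simpa only [scaledRe_sum_eq] using h

/-- The mean modulus of a block form of `d` variables tends to that of a complex Gaussian variable
with variance one, which is `√π / 2`. Only the upper bound is needed. -/
theorem exists_blockMean_lt {c : ℝ} (hc : √Real.pi / 2 < c) : ∃ d, 0 < d ∧ blockMean d < c := by
  have hpi := Real.pi_pos
  set ε : ℝ := (c - √Real.pi / 2) / (Real.pi / 2 / √2) with hε
  have hεpos : 0 < ε := div_pos (by linarith) (by positivity)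
  have hX : ∀ n, MemLp (fun θ : Polytorus => √2 * (polyFun (blockForm n 0) θ).re) 2 haar :=
    fun n => ((memLp_polyFun (blockForm n 0)).re).const_mul _
  have hX2 : ∀ n, ∫ θ, (√2 * (polyFun (blockForm n 0) θ).re) ^ 2 ∂haar ≤ 2 := by
    intro n
    rcases Nat.eq_zero_or_pos n with rfl | hn
    · simp [polyFun_blockForm]
    · have hc : Continuous fun θ => 2 * ‖polyFun (blockForm n 0) θ‖ ^ 2 :=
        continuous_const.mul ((continuous_polyFun _).norm.pow 2)
      calc ∫ θ, (√2 * (polyFun (blockForm n 0) θ).re) ^ 2 ∂haar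
          ≤ ∫ θ, 2 * ‖polyFun (blockForm n 0) θ‖ ^ 2 ∂haar := by
            refine integral_mono (hX n).integrable_sq (integrable_of_continuous hc) fun θ => ?_
            change (√2 * (polyFun (blockForm n 0) θ).re) ^ 2 ≤ 2 * ‖polyFun (blockForm n 0) θ‖ ^ 2
            rw [mul_pow, Real.sq_sqrt (by norm_num), ← sq_abs (polyFun (blockForm n 0) θ).re]
            gcongr
            exact Complex.abs_re_le_norm _
        _ = 2 := by rw [integral_const_mul, integral_norm_blockForm_sq hn, mul_one]
  have hev := eventually_integral_abs_lt tendstoInDistribution_blockForm hX two_pos hX2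
    ((memLp_id_gaussianReal 1).integrable (by norm_num)) hεpos
  obtain ⟨d, hd, hd0⟩ := (hev.and (eventually_gt_atTop 0)).exists
  refine ⟨d, hd0, ?_⟩
  simp only [id_eq] at hd
  have h1 : ∫ θ, |√2 * (polyFun (blockForm d 0) θ).re| ∂haar
      = √2 * ∫ θ, |(polyFun (blockForm d 0) θ).re| ∂haar := by
    rw [← integral_const_mul]
    congr 1
    funext θ
    rw [abs_mul, abs_of_nonneg (Real.sqrt_nonneg 2)]
  rw [h1, integral_abs_gaussianReal] at hd
  rw [blockMean, integral_norm_blockForm_eq]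
  have hs2 : √2 * √2 = (2 : ℝ) := Real.mul_self_sqrt (by norm_num)
  have hsp : √Real.pi * √Real.pi = Real.pi := Real.mul_self_sqrt hpi.le
  have h2 : Real.pi / 2 / √2 * (2 / √(2 * Real.pi)) = √Real.pi / 2 := by
    rw [Real.sqrt_mul (by norm_num)]
    nth_rw 1 [← hsp]
    field_simp
    linear_combination -hs2
  have h3 : Real.pi / 2 / √2 * ε = c - √Real.pi / 2 := by
    rw [hε]
    field_simp
  calc Real.pi / 2 * ∫ θ, |(polyFun (blockForm d 0) θ).re| ∂haar
      = Real.pi / 2 / √2 * (√2 * ∫ θ, |(polyFun (blockForm d 0) θ).re| ∂haar) := by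
        field_simp
    _ < Real.pi / 2 / √2 * (2 / √(2 * Real.pi) + ε) := by gcongr
    _ = c := by rw [mul_add, h2, h3]; ring

end BlockMean

/-! ### Independence of disjoint blocks -/

section Independence

open ProbabilityTheory

/-- Functions that depend on disjoint finite sets of coordinates are independent. -/
theorem indepFun_of_dependsOn {A B : Finset ℕ} (hAB : Disjoint A B) {F G : Polytorus → ℝ}
    (hF : Measurable F) (hG : Measurable G) (hFA : DependsOn F A) (hGB : DependsOn G B) :
    IndepFun F G haar := by
  classical
  have hind : iIndepFun (fun (i : ℕ) (θ : Polytorus) => θ i) haar :=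
    iIndepFun_infinitePi (X := fun _ x => x) fun _ => measurable_id
  have h := hind.indepFun_finset A B hAB (by fun_prop)
  -- A function that depends on the coordinates in `C` factors through their restriction, by
  -- extending the remaining coordinates by zero.
  let ext : (C : Finset ℕ) → (C → UnitAddCircle) → Polytorus :=
    fun C η n => if hn : n ∈ C then η ⟨n, hn⟩ else 0
  have hext : ∀ C, Measurable (ext C) := by
    intro C
    refine measurable_pi_lambda _ fun n => ?_
    by_cases hn : n ∈ C
    · simp only [ext, hn, dif_pos]
      exact measurable_pi_apply _
    · simp only [ext, hn, dif_neg, not_false_eq_true]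
      exact measurable_const
  have hcomp : ∀ (C : Finset ℕ) (H : Polytorus → ℝ), DependsOn H C →
      H = (H ∘ ext C) ∘ fun (θ : Polytorus) (i : C) => θ i := by
    intro C H hH
    funext θ
    refine hH fun i hi => ?_
    simp only [ext]
    rw [dif_pos (Finset.mem_coe.1 hi)]
  rw [hcomp A F hFA, hcomp B G hGB]
  exact h.comp (hF.comp (hext A)) (hG.comp (hext B))

/-- The indices of the variables in the `j`-th block. -/
def blockIndices (d j : ℕ) : Finset ℕ := (Finset.range d).image (d * j + ·)

theorem dependsOn_blockForm (d j : ℕ) :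
    DependsOn (fun θ => ‖polyFun (blockForm d j) θ‖) (blockIndices d j : Set ℕ) := by
  intro θ η h
  simp only [polyFun_blockForm, coord]
  congr 2
  refine Finset.sum_congr rfl fun i hi => ?_
  rw [h (d * j + i) (Finset.mem_coe.2 (Finset.mem_image_of_mem _ hi))]

theorem div_eq_of_mem_blockIndices {d j n : ℕ} (hn : n ∈ blockIndices d j) : n / d = j := by
  obtain ⟨i, hi, rfl⟩ := Finset.mem_image.1 hn
  have hi' := Finset.mem_range.1 hi
  rw [Nat.mul_add_div (by omega), Nat.div_eq_of_lt hi', add_zero]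

theorem integral_norm_blockForm (d j : ℕ) :
    ∫ θ, ‖polyFun (blockForm d j) θ‖ ∂haar = blockMean d := by
  have hinj : Function.Injective fun n : ℕ => d * j + n := fun a b h => by simpa using h
  have hmap : haar.map (fun (θ : Polytorus) n => θ (d * j + n)) = haar :=
    Measure.map_infinitePi_infinitePi_of_inj
      (P := fun _ : ℕ => (AddCircle.haarAddCircle : Measure UnitAddCircle)) hinj
  have hm : Measurable (fun (θ : Polytorus) n => θ (d * j + n)) := by fun_prop
  rw [blockMean]
  conv_rhs => rw [← hmap]
  rw [integral_map hm.aemeasurable (continuous_polyFun _).norm.aestronglyMeasurable]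
  simp [polyFun_blockForm, coord]

theorem integral_norm_blockProd (d : ℕ) (S : Finset ℕ) :
    ∫ θ, ‖polyFun (blockProd d S) θ‖ ∂haar = blockMean d ^ S.card := by
  classical
  have hprod : ∀ (S : Finset ℕ) θ, ‖polyFun (blockProd d S) θ‖
      = ∏ j ∈ S, ‖polyFun (blockForm d j) θ‖ := by
    intro S θ
    simp [polyFun, blockProd]
  simp only [hprod]
  induction S using Finset.induction_on with
  | empty => simp
  | insert j S hj ih =>
    simp only [Finset.prod_insert hj]
    have hdisj : Disjoint (blockIndices d j) (S.biUnion (blockIndices d)) := by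
      rw [Finset.disjoint_left]
      intro n hn hn'
      obtain ⟨k, hk, hnk⟩ := Finset.mem_biUnion.1 hn'
      rw [← div_eq_of_mem_blockIndices hn, div_eq_of_mem_blockIndices hnk] at hj
      exact hj hk
    have hdep : DependsOn (fun θ => ∏ k ∈ S, ‖polyFun (blockForm d k) θ‖)
        (S.biUnion (blockIndices d) : Set ℕ) := by
      intro θ η h
      refine Finset.prod_congr rfl fun k hk => dependsOn_blockForm d k fun i hi => h i ?_
      exact Finset.mem_coe.2 (Finset.mem_biUnion.2 ⟨k, hk, hi⟩)
    have hc1 : Continuous fun θ => ‖polyFun (blockForm d j) θ‖ := (continuous_polyFun _).norm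
    have hc2 : Continuous fun θ => ∏ k ∈ S, ‖polyFun (blockForm d k) θ‖ :=
      continuous_finsetProd _ fun k _ => (continuous_polyFun _).norm
    have hind := indepFun_of_dependsOn hdisj hc1.measurable hc2.measurable
      (dependsOn_blockForm d j) hdep
    rw [hind.integral_fun_mul_eq_mul_integral hc1.aestronglyMeasurable hc2.aestronglyMeasurable,
      ih, integral_norm_blockForm, Finset.card_insert_of_notMem hj, pow_succ']

end Independence

/-! ### Failure of boundedness and the exponent -/

section BoundedSymbol

theorem norm_hankelForm_le (ψ : Lp ℂ ∞ haar) (f g : MvPolynomial ℕ ℂ) :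
    ‖hankelForm ψ f g‖ ≤ ‖ψ‖ * ∫ θ, ‖polyFun (f * g) θ‖ ∂haar := by
  have hi : Integrable (fun θ => ‖ψ‖ * ‖polyFun (f * g) θ‖) haar :=
    integrable_of_continuous (continuous_const.mul (continuous_polyFun _).norm)
  rw [hankelForm, ← integral_const_mul]
  refine (norm_integral_le_integral_norm _).trans (integral_mono_of_nonneg
    (Filter.Eventually.of_forall fun _ => norm_nonneg _) hi ?_)
  have hψ : ∀ᵐ θ ∂haar, ‖ψ θ‖ ≤ ‖ψ‖ := by
    filter_upwards [ae_le_eLpNormEssSup (f := ψ) (μ := haar)] with θ hθ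
    rw [Lp.norm_def, eLpNorm_exponent_top, ← toReal_enorm]
    refine ENNReal.toReal_mono ?_ hθ
    rw [← eLpNorm_exponent_top]
    exact Lp.eLpNorm_ne_top ψ
  filter_upwards [hψ] with θ hθ
  have h : polyFun (f * g) θ = polyFun f θ * polyFun g θ := by simp [polyFun]
  rw [h, norm_mul _ (conj _), RCLike.norm_conj, mul_comm]
  gcongr

/-- Testing a bounded symbol `ψ` against `Φ_m` gives `r ^ m ≤ ‖ψ‖ * blockMean d ^ (m + 1)` for
every `m`, which is impossible if `blockMean d < r`. -/
theorem not_hasBoundedSymbol_symbol {d : ℕ} {r : ℝ} (hd : 0 < d) (hr : blockMean d < r)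
    (h1 : r < 1) : ¬ HasBoundedSymbol (symbol d r) := by
  have ha : 0 ≤ blockMean d := integral_nonneg fun _ => norm_nonneg _
  have h0 : 0 < r := ha.trans_lt hr
  rintro ⟨ψ, hψ⟩
  have hbound : ∀ m : ℕ, r ^ m ≤ ‖ψ‖ * blockMean d ^ (m + 1) := by
    intro m
    have h := norm_hankelForm_le ψ (blockProd d (blockGroup m)) 1
    rwa [← hψ, hankelForm_eq_inner, mul_one, inner_symbol_blockProd hd h0.le h1,
      integral_norm_blockProd, card_blockGroup, Complex.norm_real, Real.norm_eq_abs,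
      abs_of_pos (pow_pos h0 m)] at h
  have hlim : Filter.Tendsto (fun m : ℕ => ‖ψ‖ * blockMean d * (blockMean d / r) ^ m)
      Filter.atTop (nhds 0) := by
    have h := (tendsto_pow_atTop_nhds_zero_of_lt_one (div_nonneg ha h0.le)
      ((div_lt_one h0).2 hr)).const_mul (‖ψ‖ * blockMean d)
    rwa [mul_zero] at h
  obtain ⟨m, hm⟩ := (hlim.eventually_lt_const one_pos).exists
  have h2 := hbound m
  rw [div_pow, ← mul_div_assoc, div_lt_one (pow_pos h0 m)] at hm
  rw [pow_succ] at h2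
  linarith

theorem two_rpow_neg_inv_lt_one {p : ℝ} (hp0 : 0 < p) : (2 : ℝ) ^ (-p⁻¹) < 1 :=
  Real.rpow_lt_one_of_one_lt_of_neg one_lt_two (by simpa using hp0)

theorem exponent_pos : 0 < 1 - Real.log Real.pi / Real.log 4 := by
  have h4 : 0 < Real.log 4 := Real.log_pos (by norm_num)
  rw [sub_pos, div_lt_one h4]
  exact Real.log_lt_log Real.pi_pos (by linarith [Real.pi_lt_four])

theorem sqrt_pi_div_two_lt {p : ℝ} (hp : (1 - Real.log Real.pi / Real.log 4)⁻¹ < p) :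
    √Real.pi / 2 < 2 ^ (-p⁻¹) := by
  have h2 : 0 < Real.log 2 := Real.log_pos one_lt_two
  have h := inv_lt_of_inv_lt₀ exponent_pos hp
  have h4 : Real.log 4 = 2 * Real.log 2 := by
    rw [show (4 : ℝ) = 2 ^ 2 by norm_num, Real.log_pow]
    norm_num
  have hs : 0 < √Real.pi := Real.sqrt_pos.2 Real.pi_pos
  rw [← Real.log_lt_log_iff (by positivity) (by positivity), Real.log_rpow two_pos,
    Real.log_div hs.ne' two_ne_zero, Real.log_sqrt Real.pi_pos.le]
  rw [h4, lt_sub_iff_add_lt, ← lt_sub_iff_add_lt', div_lt_iff₀ (by positivity)] at h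
  linarith

end BoundedSymbol

end MultHankel
end

theorem mainTheorem1 (p : ℝ) (hp : (1 - Real.log Real.pi / Real.log 4)⁻¹ < p) :
    ∃ φ : MultHankel.L2,
      MultHankel.HankelInSchatten p φ ∧ ¬ MultHankel.HasBoundedSymbol φ := by
  have hp0 : 0 < p := (inv_pos.2 MultHankel.exponent_pos).trans hp
  obtain ⟨d, hd, hmean⟩ := MultHankel.exists_blockMean_lt (MultHankel.sqrt_pi_div_two_lt hp)
  obtain ⟨r, hr, hr2⟩ := exists_between hmean
  have h0 : 0 < r :=
    (integral_nonneg fun _ => norm_nonneg _ : 0 ≤ MultHankel.blockMean d).trans_lt hr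
  have h1 : r < 1 := hr2.trans (MultHankel.two_rpow_neg_inv_lt_one hp0)
  refine ⟨MultHankel.symbol d r, MultHankel.hankelInSchatten_symbol hd h0 h1 hp0 ?_,
    MultHankel.not_hasBoundedSymbol_symbol hd hr h1⟩
  have h2 : r ^ p < 2⁻¹ := by
    calc r ^ p < ((2 : ℝ) ^ (-p⁻¹)) ^ p := Real.rpow_lt_rpow h0.le hr2 hp0
      _ = 2⁻¹ := by
        rw [← Real.rpow_mul two_pos.le, neg_mul, inv_mul_cancel₀ hp0.ne', Real.rpow_neg_one]
  linarith
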